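/- For a finite simple undirected graph $G=(V,E)$ and $V'\subseteq V$ let $m_1=|E(V')|$ be the number of edges with both endpoints in $V'$ and $m_2=|E(V',V\setminus V')|$ the number of edges with exactly one endpoint in $V'$. A local graph partitioning problem $\mathcal L(\mathrm{goal},\alpha_1,\alpha_2)$, with fixed $\alpha_1,\alpha_2\in\mathbb R$ and $\mathrm{goal}\in\{\max,\min\}$, asks, given $G$ and integers $k\ge 0$ and $p$, whether there is a set $V'\subseteq V$ with $|V'|=k$ and $\alpha_1m_1+\alpha_2m_2\ge p$ (if $\mathrm{goal}=\max$), respectively $\alpha_1m_1+\alpha_2m_2\le p$ (if $\mathrm{goal}=\min$). **Proposition.** Every local graph partitioning problem can be solved in time $O^*(2^{\mathrm{tw}})$, where $\mathrm{tw}$ is the treewidth of $G$, when the input graph is given together with a tree decomposition of minimum width. More generally: for every problem $\mathcal L(\mathrm{goal},\alpha_1,\alpha_2)$ there are an algorithm and constants $C,d\in\mathbb N$ such that, given a graph $G$ on $n$ vertices, $k$, $p$, and any tree decomposition of $G$ with $m$ nodes and of width $w$, the algorithm correctly decides the instance $(G,k,p)$ in at most $C\cdot 2^{w}\cdot(n+m+1)^d$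 steps. In particular, it takes at most $C\cdot 2^{\mathrm{tw}}\cdot(n+m+1)^d$ steps if $w=\mathrm{tw}$. Here a step is an elementary operation of a random access machine with uniform cost which can read and write memory cells with indirect addressing, add, subtract (truncated at $0$) and compare natural numbers, and add, subtract and compare real numbers; its only real constants are $0,\alpha_1,\alpha_2$. The width of a tree decomposition is the maximum size of a bag minus one (by convention $0$ if all bags are empty), and $\mathrm{tw}$ is the minimum width of a tree decomposition of $G$. -/

import Mathlib

/-! ### Local graph partitioning problems -/

namespace LocalPartition

/-- `|E(S)|`: the number of edges of `G` with both endpoints in `S`. -/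
noncomputable def innerEdges {V : Type*} (G : SimpleGraph V) (S : Finset V) : ℕ :=
  {e : Sym2 V | e ∈ G.edgeSet ∧ ∀ v ∈ e, v ∈ S}.ncard

/-- `|E(S, V \ S)|`: the number of edges of `G` with one endpoint in `S` and one outside `S`. -/
noncomputable def cutEdges {V : Type*} (G : SimpleGraph V) (S : Finset V) : ℕ :=
  {e : Sym2 V | e ∈ G.edgeSet ∧ (∃ v ∈ e, v ∈ S) ∧ (∃ v ∈ e, v ∉ S)}.ncard

inductive Objective where
  | maximize
  | minimize

/-- A local graph partitioning problem is determined by its goal and two real coefficients. -/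
structure Problem where
  goal : Objective
  α₁ : ℝ
  α₂ : ℝ

/-- The value of a vertex subset. -/
noncomputable def Problem.val (L : Problem) {V : Type*} (G : SimpleGraph V) (S : Finset V) : ℝ :=
  L.α₁ * innerEdges G S + L.α₂ * cutEdges G S

/-- `(G, k, p)` is a yes-instance: some `k`-subset has value at least `p` (maximization),
respectively at most `p` (minimization). -/
def Problem.IsYes (L : Problem) {V : Type*} (G : SimpleGraph V) (k : ℕ) (p : ℤ) : Prop :=
  ∃ S : Finset V, S.card = k ∧
    match L.goal with
    | .maximize => (p : ℝ) ≤ L.val G S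
    | .minimize => L.val G S ≤ (p : ℝ)

/-! ### Tree decompositions and treewidth -/

/-- A tree decomposition of `G` whose tree has the nodes `0, …, m - 1`. -/
structure TreeDecomposition {V : Type*} (G : SimpleGraph V) (m : ℕ) where
  tree : SimpleGraph (Fin m)
  isTree : tree.IsTree
  bag : Fin m → Finset V
  cover : ∀ v, ∃ i, v ∈ bag i
  edge_cover : ∀ u v, G.Adj u v → ∃ i, u ∈ bag i ∧ v ∈ bag i
  subtree : ∀ v, (tree.induce {i | v ∈ bag i}).Connected

/-- The maximal size of a bag, minus one (and `0` if all bags are empty). -/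
def TreeDecomposition.width {V : Type*} {G : SimpleGraph V} {m : ℕ}
    (D : TreeDecomposition G m) : ℕ :=
  (Finset.univ.sup fun i => (D.bag i).card) - 1

/-- The least width of a tree decomposition. -/
noncomputable def treewidth {V : Type*} (G : SimpleGraph V) : ℕ :=
  sInf {w | ∃ (m : ℕ) (D : TreeDecomposition G m), D.width = w}

/-! ### The machine model

A random access machine under the uniform cost criterion, programmed with structured control flow.
It has variables and arrays for natural numbers and, separately, for real numbers.
Natural numbers serve as data and as addresses; the arithmetic on them is addition and truncated
subtraction (no unit-cost multiplication).  Real numbers can only be copied, added, subtracted and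
compared, and the only real constants are `0` and what the input supplies.
Variables and arrays are referred to by fixed numbers in the program text. -/

/-- A memory state. -/
structure Mem where
  natVar : ℕ → ℕ
  natArr : ℕ → ℕ → ℕ
  realVar : ℕ → ℝ
  realArr : ℕ → ℕ → ℝ

/-- Natural number expressions. -/
inductive NExpr where
  | const (c : ℕ)
  | var (x : ℕ)
  | arr (a : ℕ) (i : NExpr)
  | add (e f : NExpr)
  | sub (e f : NExpr)

/-- Real number expressions. -/
inductive RExpr where
  | zero
  | var (x : ℕ)
  | arr (a : ℕ) (i : NExpr)
  | add (e f : RExpr)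
  | sub (e f : RExpr)

/-- Tests. -/
inductive BExpr where
  | natEq (e f : NExpr)
  | natLe (e f : NExpr)
  | realLe (e f : RExpr)
  | not (b : BExpr)
  | and (b c : BExpr)

/-- Programs. -/
inductive Prog where
  | skip
  | setNat (x : ℕ) (e : NExpr)
  | storeNat (a : ℕ) (i e : NExpr)
  | setReal (x : ℕ) (e : RExpr)
  | storeReal (a : ℕ) (i : NExpr) (e : RExpr)
  | seq (P Q : Prog)
  | ite (b : BExpr) (P Q : Prog)
  | loop (b : BExpr) (P : Prog)

def NExpr.eval (s : Mem) : NExpr → ℕ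
  | .const c => c
  | .var x => s.natVar x
  | .arr a i => s.natArr a (i.eval s)
  | .add e f => e.eval s + f.eval s
  | .sub e f => e.eval s - f.eval s

/-- The number of operations needed to evaluate an expression. -/
def NExpr.cost : NExpr → ℕ
  | .const _ => 1
  | .var _ => 1
  | .arr _ i => i.cost + 1
  | .add e f => e.cost + f.cost + 1
  | .sub e f => e.cost + f.cost + 1

noncomputable def RExpr.eval (s : Mem) : RExpr → ℝ
  | .zero => 0
  | .var x => s.realVar x
  | .arr a i => s.realArr a (i.eval s)
  | .add e f => e.eval s + f.eval s
  | .sub e f => e.eval s - f.eval s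

def RExpr.cost : RExpr → ℕ
  | .zero => 1
  | .var _ => 1
  | .arr _ i => i.cost + 1
  | .add e f => e.cost + f.cost + 1
  | .sub e f => e.cost + f.cost + 1

def BExpr.Holds (s : Mem) : BExpr → Prop
  | .natEq e f => e.eval s = f.eval s
  | .natLe e f => e.eval s ≤ f.eval s
  | .realLe e f => e.eval s ≤ f.eval s
  | .not b => ¬ b.Holds s
  | .and b c => b.Holds s ∧ c.Holds s

def BExpr.cost : BExpr → ℕ
  | .natEq e f => e.cost + f.cost + 1
  | .natLe e f => e.cost + f.cost + 1
  | .realLe e f => e.cost + f.cost + 1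
  | .not b => b.cost + 1
  | .and b c => b.cost + c.cost + 1

def Mem.setNat (s : Mem) (x v : ℕ) : Mem :=
  { s with natVar := Function.update s.natVar x v }

def Mem.storeNat (s : Mem) (a i v : ℕ) : Mem :=
  { s with natArr := Function.update s.natArr a (Function.update (s.natArr a) i v) }

noncomputable def Mem.setReal (s : Mem) (x : ℕ) (v : ℝ) : Mem :=
  { s with realVar := Function.update s.realVar x v }

noncomputable def Mem.storeReal (s : Mem) (a i : ℕ) (v : ℝ) : Mem :=
  { s with realArr := Function.update s.realArr a (Function.update (s.realArr a) i v) }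

/-- `Run P s s' t`: started in memory state `s`, the program `P` halts after `t` elementary
operations in memory state `s'`. -/
inductive Run : Prog → Mem → Mem → ℕ → Prop
  | skip (s) : Run .skip s s 1
  | setNat (s x e) : Run (.setNat x e) s (s.setNat x (e.eval s)) (e.cost + 1)
  | storeNat (s a i e) :
      Run (.storeNat a i e) s (s.storeNat a (i.eval s) (e.eval s)) (i.cost + e.cost + 1)
  | setReal (s x e) : Run (.setReal x e) s (s.setReal x (e.eval s)) (e.cost + 1)
  | storeReal (s a i e) :
      Run (.storeReal a i e) s (s.storeReal a (i.eval s) (e.eval s)) (i.cost + e.cost + 1)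
  | seq {P Q s s' s'' t t'} (hP : Run P s s' t) (hQ : Run Q s' s'' t') :
      Run (.seq P Q) s s'' (t + t')
  | iteTrue {b P Q s s' t} (hb : b.Holds s) (hP : Run P s s' t) :
      Run (.ite b P Q) s s' (b.cost + 1 + t)
  | iteFalse {b P Q s s' t} (hb : ¬ b.Holds s) (hQ : Run Q s s' t) :
      Run (.ite b P Q) s s' (b.cost + 1 + t)
  | loopStop {b P s} (hb : ¬ b.Holds s) : Run (.loop b P) s s (b.cost + 1)
  | loopStep {b P s s' s'' t t'} (hb : b.Holds s) (hP : Run P s s' t)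
      (hL : Run (.loop b P) s' s'' t') : Run (.loop b P) s s'' (b.cost + 1 + t + t')

/-- The machine is deterministic: final state and running time are determined by the start. -/
theorem Run.deterministic {P : Prog} {s s₁ s₂ : Mem} {t₁ t₂ : ℕ} (h₁ : Run P s s₁ t₁)
    (h₂ : Run P s s₂ t₂) : s₁ = s₂ ∧ t₁ = t₂ := by
  induction h₁ generalizing s₂ t₂ with
  | skip | setNat | storeNat | setReal | storeReal => cases h₂; exact ⟨rfl, rfl⟩
  | seq _ _ ih ih' =>
    cases h₂ with
    | seq hP hQ =>
      obtain ⟨rfl, rfl⟩ := ih hP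
      obtain ⟨rfl, rfl⟩ := ih' hQ
      exact ⟨rfl, rfl⟩
  | iteTrue hb _ ih =>
    cases h₂ with
    | iteTrue _ hP =>
      obtain ⟨rfl, rfl⟩ := ih hP
      exact ⟨rfl, rfl⟩
    | iteFalse hb' _ => exact absurd hb hb'
  | iteFalse hb _ ih =>
    cases h₂ with
    | iteTrue hb' _ => exact absurd hb' hb
    | iteFalse _ hP =>
      obtain ⟨rfl, rfl⟩ := ih hP
      exact ⟨rfl, rfl⟩
  | loopStop hb =>
    cases h₂ with
    | loopStop _ => exact ⟨rfl, rfl⟩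
    | loopStep hb' _ _ => exact absurd hb' hb
  | loopStep hb _ _ ih ih' =>
    cases h₂ with
    | loopStop hb' => exact absurd hb hb'
    | loopStep _ hP hL =>
      obtain ⟨rfl, rfl⟩ := ih hP
      obtain ⟨rfl, rfl⟩ := ih' hL
      exact ⟨rfl, rfl⟩

/-! ### Input -/

open Classical in
/-- The 0-1 matrix of a relation, stored row by row; rows have length `c`. -/
noncomputable def matrixArray {r c : ℕ} (R : Fin r → Fin c → Prop) (x : ℕ) : ℕ :=
  if ∃ (i : Fin r) (j : Fin c), x = i * c + j ∧ R i j then 1 else 0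

/-- The initial memory.  Natural variables `0, 1, 2` hold the number `n` of vertices, the number
`m` of nodes of the decomposition tree, and `k`; natural arrays `0, 1, 2` hold the adjacency matrix
of `G`, the adjacency matrix of the tree, and the node-vertex incidence matrix of the bags.
Real variables `0, 1, 2` hold the two coefficients of the problem and `p`.
Everything else is `0`. -/
noncomputable def inputMem (L : Problem) {n m : ℕ} (G : SimpleGraph (Fin n)) (k : ℕ) (p : ℤ)
    (D : TreeDecomposition G m) : Mem where
  natVar
    | 0 => n
    | 1 => m
    | 2 => k
    | _ => 0
  natArr
    | 0 => matrixArray G.Adj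
    | 1 => matrixArray D.tree.Adj
    | 2 => matrixArray fun i v => v ∈ D.bag i
    | _ => fun _ => 0
  realVar
    | 0 => L.α₁
    | 1 => L.α₂
    | 2 => p
    | _ => 0
  realArr := fun _ _ => 0

/-- The answer given by a final memory state: `1` (yes) or `0` (no) in natural variable `0`. -/
def AnswersCorrectly (s : Mem) (yes : Prop) : Prop :=
  (yes → s.natVar 0 = 1) ∧ (¬ yes → s.natVar 0 = 0)

end LocalPartition

/-! Changing the signs of the two coefficients and of `p` turns maximization into minimization, so
it suffices to know, for every size, the least value of a set of that size. A value is a sum of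
contributions of edges (`sum_pairWeight`). The minima for all sizes at once are the coefficients of
a polynomial over the min-plus semiring (`partialSum`): multiplying polynomials adds sizes and
values, adding them takes minima. Dynamic programming thereby becomes the distributive law in a
commutative semiring.

The tree is taken apart leaf by leaf. A further node `m` with empty bag serves as root. If an
unprocessed node `c` has at most one unprocessed neighbour, let `p` be that neighbour, or the root
if there is none. By connectedness the vertices of `B c \ B p` occur in no other unprocessed bag, so
they can be optimized away now. The invariant `Decomp.Inv` says that the optimum over the vertices
already eliminated, given the choice `Y` of the others, is the product of the table entries at `Y ∩
B d` over the processed nodes `d` whose parent is unprocessed. `Decomp.Inv.step` restores it when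
`c` receives its table; `partialSum_union` and `message_eq` do the computation. A vertex is counted
when it leaves the bags, an edge when its ends stop sharing a bag, so nothing is counted twice and
tables multiply without corrections. At the end the root's entry is the full generating function
(`Decomp.Inv.newTable_root`).

For a subset `S` of a bag each child contributes one entry, at `S ∩ B d`; convolution takes place
only in the size. Hence a node costs `2 ^ |bag|` times a polynomial, and pairs of subsets never
arise.

The algorithm is written with counting loops only. Its effect is then a function (`FProg.exec`) and
is analysed by loop invariants, while `FProg.run_compile` reads the running time off the nesting of
loops: the limits of nested loops multiply. Only the loop over subsets has an exponential limit, it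
is not nested in itself, and the limit is at most `2 ^ (w + 1)`. Table addresses are sums of
distinct powers of two, hence unambiguous; an unwritten cell reads as infinity, so the exponentially
large tables need no initialization. -/

namespace LocalPartition

/-! ### Reading memory after a write -/

section MemLemmas

variable (s : Mem) (x y a b i j v : ℕ) (r : ℝ)

@[simp] theorem Mem.setNat_natVar :
    (s.setNat x v).natVar y = if y = x then v else s.natVar y := by
  simp [Mem.setNat, Function.update_apply]

@[simp] theorem Mem.setNat_natArr : (s.setNat x v).natArr = s.natArr := rfl
@[simp] theorem Mem.setNat_realVar : (s.setNat x v).realVar = s.realVar := rfl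
@[simp] theorem Mem.setNat_realArr : (s.setNat x v).realArr = s.realArr := rfl

@[simp] theorem Mem.storeNat_natArr :
    (s.storeNat a i v).natArr b j = if b = a ∧ j = i then v else s.natArr b j := by
  by_cases hb : b = a
  · subst hb; simp [Mem.storeNat, Function.update_apply]
  · simp [Mem.storeNat, hb]

@[simp] theorem Mem.storeNat_natVar : (s.storeNat a i v).natVar = s.natVar := rfl
@[simp] theorem Mem.storeNat_realVar : (s.storeNat a i v).realVar = s.realVar := rfl
@[simp] theorem Mem.storeNat_realArr : (s.storeNat a i v).realArr = s.realArr := rfl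

@[simp] theorem Mem.setReal_realVar :
    (s.setReal x r).realVar y = if y = x then r else s.realVar y := by
  simp [Mem.setReal, Function.update_apply]

@[simp] theorem Mem.setReal_natVar : (s.setReal x r).natVar = s.natVar := rfl
@[simp] theorem Mem.setReal_natArr : (s.setReal x r).natArr = s.natArr := rfl
@[simp] theorem Mem.setReal_realArr : (s.setReal x r).realArr = s.realArr := rfl

@[simp] theorem Mem.storeReal_realArr :
    (s.storeReal a i r).realArr b j = if b = a ∧ j = i then r else s.realArr b j := by
  by_cases hb : b = a
  · subst hb; simp [Mem.storeReal, Function.update_apply]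
  · simp [Mem.storeReal, hb]

@[simp] theorem Mem.storeReal_natVar : (s.storeReal a i r).natVar = s.natVar := rfl
@[simp] theorem Mem.storeReal_natArr : (s.storeReal a i r).natArr = s.natArr := rfl
@[simp] theorem Mem.storeReal_realVar : (s.storeReal a i r).realVar = s.realVar := rfl

end MemLemmas

/-! ### Programs with bounded loops

Programs whose only loops run a counter from `0` up to the value of a fixed variable.  They always
halt, so their effect is a function on memory states. -/

/-- Programs with bounded loops; `forN x y P` runs `P` for the values of variable `x` from `0` up
to the value of variable `y` (exclusive). -/
inductive FProg where
  | skip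
  | setN (x : ℕ) (e : NExpr)
  | stN (a : ℕ) (i e : NExpr)
  | setR (x : ℕ) (e : RExpr)
  | stR (a : ℕ) (i : NExpr) (e : RExpr)
  | seq (P Q : FProg)
  | ite (b : BExpr) (P Q : FProg)
  | forN (x y : ℕ) (P : FProg)

namespace FProg

/-- Translation into the machine language. -/
def compile : FProg → Prog
  | skip => .skip
  | setN x e => .setNat x e
  | stN a i e => .storeNat a i e
  | setR x e => .setReal x e
  | stR a i e => .storeReal a i e
  | seq P Q => .seq P.compile Q.compile
  | ite b P Q => .ite b P.compile Q.compile
  | forN x y P => .seq (.setNat x (.const 0))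
      (.loop (.not (.natLe (.var y) (.var x)))
        (.seq P.compile (.setNat x (.add (.var x) (.const 1)))))

open Classical in
/-- The effect of a program. -/
noncomputable def exec : FProg → Mem → Mem
  | skip, s => s
  | setN x e, s => s.setNat x (e.eval s)
  | stN a i e, s => s.storeNat a (i.eval s) (e.eval s)
  | setR x e, s => s.setReal x (e.eval s)
  | stR a i e, s => s.storeReal a (i.eval s) (e.eval s)
  | seq P Q, s => Q.exec (P.exec s)
  | ite b P Q, s => if b.Holds s then P.exec s else Q.exec s
  | forN x y P, s =>
      Nat.rec (s.setNat x 0) (fun i s' => (P.exec s').setNat x (i + 1)) (s.natVar y)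

/-- Does the program write to the given variable for natural numbers? -/
def wn : FProg → ℕ → Bool
  | setN x _, y => x == y
  | seq P Q, y => P.wn y || Q.wn y
  | ite _ P Q, y => P.wn y || Q.wn y
  | forN x _ P, y => x == y || P.wn y
  | _, _ => false

/-- Does the program write to the given array of natural numbers? -/
def wa : FProg → ℕ → Bool
  | stN a _ _, b => a == b
  | seq P Q, y => P.wa y || Q.wa y
  | ite _ P Q, y => P.wa y || Q.wa y
  | forN _ _ P, y => P.wa y
  | _, _ => false

/-- Does the program write to the given real variable? -/
def wr : FProg → ℕ → Bool
  | setR x _, y => x == y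
  | seq P Q, y => P.wr y || Q.wr y
  | ite _ P Q, y => P.wr y || Q.wr y
  | forN _ _ P, y => P.wr y
  | _, _ => false

/-- Does the program write to the given array of real numbers? -/
def wra : FProg → ℕ → Bool
  | stR a _ _, b => a == b
  | seq P Q, y => P.wra y || Q.wra y
  | ite _ P Q, y => P.wra y || Q.wra y
  | forN _ _ P, y => P.wra y
  | _, _ => false

/-- `s'` agrees with `s` wherever `P` does not write. -/
structure Frame (P : FProg) (s s' : Mem) : Prop where
  nv : ∀ y, P.wn y = false → s'.natVar y = s.natVar y
  na : ∀ a, P.wa a = false → s'.natArr a = s.natArr a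
  rv : ∀ y, P.wr y = false → s'.realVar y = s.realVar y
  ra : ∀ a, P.wra a = false → s'.realArr a = s.realArr a

theorem Frame.trans {P : FProg} {s s' s'' : Mem} (h : Frame P s s') (h' : Frame P s' s'') :
    Frame P s s'' :=
  ⟨fun y hy => (h'.nv y hy).trans (h.nv y hy), fun y hy => (h'.na y hy).trans (h.na y hy),
    fun y hy => (h'.rv y hy).trans (h.rv y hy), fun y hy => (h'.ra y hy).trans (h.ra y hy)⟩

theorem exec_frame (P : FProg) (s : Mem) : Frame P s (P.exec s) := by
  induction P generalizing s with
  | skip => exact ⟨fun _ _ => rfl, fun _ _ => rfl, fun _ _ => rfl, fun _ _ => rfl⟩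
  | setN x e =>
    refine ⟨fun y h => ?_, fun _ _ => rfl, fun _ _ => rfl, fun _ _ => rfl⟩
    simp only [wn, beq_eq_false_iff_ne] at h
    simp [exec, h.symm]
  | stN a i e =>
    refine ⟨fun _ _ => rfl, fun y h => ?_, fun _ _ => rfl, fun _ _ => rfl⟩
    simp only [wa, beq_eq_false_iff_ne] at h
    ext j
    simp [exec, h.symm]
  | setR x e =>
    refine ⟨fun _ _ => rfl, fun _ _ => rfl, fun y h => ?_, fun _ _ => rfl⟩
    simp only [wr, beq_eq_false_iff_ne] at h
    simp [exec, h.symm]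
  | stR a i e =>
    refine ⟨fun _ _ => rfl, fun _ _ => rfl, fun _ _ => rfl, fun y h => ?_⟩
    simp only [wra, beq_eq_false_iff_ne] at h
    ext j
    simp [exec, h.symm]
  | seq P Q ihP ihQ =>
    have hP := ihP s
    have hQ := ihQ (P.exec s)
    constructor <;> intro y h <;> simp only [wn, wa, wr, wra, Bool.or_eq_false_iff] at h
    · exact (hQ.nv y h.2).trans (hP.nv y h.1)
    · exact (hQ.na y h.2).trans (hP.na y h.1)
    · exact (hQ.rv y h.2).trans (hP.rv y h.1)
    · exact (hQ.ra y h.2).trans (hP.ra y h.1)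
  | ite b P Q ihP ihQ =>
    have hP := ihP s
    have hQ := ihQ s
    simp only [exec]
    constructor <;> intro y h <;> simp only [wn, wa, wr, wra, Bool.or_eq_false_iff] at h <;>
      split_ifs
    · exact hP.nv y h.1
    · exact hQ.nv y h.2
    · exact hP.na y h.1
    · exact hQ.na y h.2
    · exact hP.rv y h.1
    · exact hQ.rv y h.2
    · exact hP.ra y h.1
    · exact hQ.ra y h.2
  | forN x y P ih =>
    simp only [exec]
    induction s.natVar y with
    | zero =>
      refine ⟨fun z h => ?_, fun _ _ => rfl, fun _ _ => rfl, fun _ _ => rfl⟩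
      simp only [wn, Bool.or_eq_false_iff, beq_eq_false_iff_ne] at h
      simp [h.1.symm]
    | succ N ihN =>
      have hP := ih (Nat.rec (s.setNat x 0) (fun i s' => (P.exec s').setNat x (i + 1)) N)
      refine ihN.trans ⟨fun z h => ?_, fun z h => ?_, fun z h => ?_, fun z h => ?_⟩
      · simp only [wn, Bool.or_eq_false_iff, beq_eq_false_iff_ne] at h
        simpa [h.1.symm] using hP.nv z h.2
      · exact hP.na z h
      · exact hP.rv z h
      · exact hP.ra z h

section FrameAccess

variable (P : FProg) (s : Mem)

theorem exec_natVar {y : ℕ} (h : P.wn y = false := by rfl) :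
    (P.exec s).natVar y = s.natVar y := (P.exec_frame s).nv y h

theorem exec_natArr {y : ℕ} (h : P.wa y = false := by rfl) :
    (P.exec s).natArr y = s.natArr y := (P.exec_frame s).na y h

theorem exec_realVar {y : ℕ} (h : P.wr y = false := by rfl) :
    (P.exec s).realVar y = s.realVar y := (P.exec_frame s).rv y h

theorem exec_realArr {y : ℕ} (h : P.wra y = false := by rfl) :
    (P.exec s).realArr y = s.realArr y := (P.exec_frame s).ra y h

end FrameAccess

/-- Loop invariants. -/
theorem forN_induct {x y : ℕ} {P : FProg} {s : Mem} (I : ℕ → Mem → Prop)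
    (h0 : I 0 (s.setNat x 0))
    (hs : ∀ i s', i < s.natVar y → Frame (forN x y P) s s' → s'.natVar x = i → I i s' →
      I (i + 1) ((P.exec s').setNat x (i + 1))) :
    I (s.natVar y) ((forN x y P).exec s) := by
  have key : ∀ N ≤ s.natVar y,
      let s' : Mem := Nat.rec (s.setNat x 0) (fun i s' => (P.exec s').setNat x (i + 1)) N
      Frame (forN x y P) s s' ∧ s'.natVar x = N ∧ I N s' := by
    intro N
    induction N with
    | zero =>
      refine fun _ => ⟨⟨fun z h => ?_, fun _ _ => rfl, fun _ _ => rfl, fun _ _ => rfl⟩, ?_, h0⟩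
      · simp only [wn, Bool.or_eq_false_iff, beq_eq_false_iff_ne] at h
        simp [h.1.symm]
      · simp
    | succ N ih =>
      intro hN
      obtain ⟨hf, hx, hI⟩ := ih (by omega)
      refine ⟨hf.trans ?_, by simp, hs N _ (by omega) hf hx hI⟩
      have hP := P.exec_frame (Nat.rec (s.setNat x 0) (fun i s' => (P.exec s').setNat x (i + 1)) N)
      refine ⟨fun z h => ?_, fun z h => ?_, fun z h => ?_, fun z h => ?_⟩
      · simp only [wn, Bool.or_eq_false_iff, beq_eq_false_iff_ne] at h
        simpa [h.1.symm] using hP.nv z h.2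
      · exact hP.na z h
      · exact hP.rv z h
      · exact hP.ra z h
  exact (key _ le_rfl).2.2

/-! ### Running time -/

/-- The loop limits are among the variables in `L`, and neither these nor active loop counters are
overwritten. -/
def ok (L : List ℕ) : FProg → Bool
  | setN x _ => !L.contains x
  | seq P Q => P.ok L && Q.ok L
  | ite _ P Q => P.ok L && Q.ok L
  | forN x y P => !L.contains x && L.contains y && !P.wn x && P.ok L
  | _ => true

theorem wn_eq_false_of_ok {L : List ℕ} {P : FProg} (h : P.ok L = true) {y : ℕ} (hy : y ∈ L) :
    P.wn y = false := by
  induction P with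
  | setN x e =>
    simp only [ok, Bool.not_eq_true', wn, beq_eq_false_iff_ne] at h ⊢
    rintro rfl
    simp [hy] at h
  | seq P Q ihP ihQ | ite b P Q ihP ihQ =>
    simp only [ok, Bool.and_eq_true] at h
    simp [wn, ihP h.1, ihQ h.2]
  | forN x z P ih =>
    simp only [ok, Bool.and_eq_true, Bool.not_eq_true'] at h
    have : x ≠ y := by
      rintro rfl
      simp [hy] at h
    simp [wn, ih h.2, this]
  | _ => rfl

/-- The coefficient of the running time bound. -/
def coef : FProg → ℕ
  | skip => 1
  | setN _ e => e.cost + 1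
  | stN _ i e => i.cost + e.cost + 1
  | setR _ e => e.cost + 1
  | stR _ i e => i.cost + e.cost + 1
  | seq P Q => P.coef + Q.coef
  | ite b P Q => b.cost + 1 + (P.coef + Q.coef)
  | forN _ _ P => P.coef + 16

/-- The nesting depth of loops, except for those with limit variable `z`. -/
def depth (z : ℕ) : FProg → ℕ
  | seq P Q => max (P.depth z) (Q.depth z)
  | ite _ P Q => max (P.depth z) (Q.depth z)
  | forN _ y P => if y = z then P.depth z else P.depth z + 1
  | _ => 0

/-- The nesting depth of loops with limit variable `z`. -/
def expDepth (z : ℕ) : FProg → ℕ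
  | seq P Q => max (P.expDepth z) (Q.expDepth z)
  | ite _ P Q => max (P.expDepth z) (Q.expDepth z)
  | forN _ y P => if y = z then P.expDepth z + 1 else P.expDepth z
  | _ => 0

/-- The compiled loop tests its limit anew in each pass, while `exec` fixes the number of passes
beforehand; they agree because the body writes neither the counter nor the limit. Besides the body,
a pass costs 5 for the test and 4 for the increment; initialization costs 2 and the last test 5. -/
theorem run_loop {x y : ℕ} {P : FProg} {s : Mem} {T : ℕ} (hxy : x ≠ y) (hx : P.wn x = false)
    (hy : P.wn y = false)
    (hP : ∀ s' : Mem, Frame (forN x y P) s s' → ∃ t, Run P.compile s' (P.exec s') t ∧ t ≤ T) :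
    ∃ t, Run (forN x y P).compile s ((forN x y P).exec s) t ∧ t ≤ s.natVar y * (T + 9) + 7 := by
  set st : ℕ → Mem := fun N =>
    Nat.rec (s.setNat x 0) (fun i s' => (P.exec s').setNat x (i + 1)) N with hst
  have hfr : ∀ N, Frame (forN x y P) s (st N) ∧ (st N).natVar x = N := by
    intro N
    induction N with
    | zero =>
      refine ⟨⟨fun z h => ?_, fun _ _ => rfl, fun _ _ => rfl, fun _ _ => rfl⟩, by simp [hst]⟩
      simp only [wn, Bool.or_eq_false_iff, beq_eq_false_iff_ne] at h
      simp [hst, h.1.symm]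
    | succ N ih =>
      have hP := P.exec_frame (st N)
      refine ⟨ih.1.trans ⟨fun z h => ?_, fun z h => hP.na z h, fun z h => hP.rv z h,
        fun z h => hP.ra z h⟩, by simp [hst]⟩
      simp only [wn, Bool.or_eq_false_iff, beq_eq_false_iff_ne] at h
      simpa [h.1.symm, hst] using hP.nv z h.2
  have hyN : ∀ N, (st N).natVar y = s.natVar y := fun N =>
    (hfr N).1.nv y (by simp [wn, hxy, hy])
  -- Induction on the number `M` of passes still to come, since a run of a loop is built from its
  -- end.
  have key : ∀ M N, M + N = s.natVar y → ∃ t,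
      Run (.loop (.not (.natLe (.var y) (.var x)))
        (.seq P.compile (.setNat x (.add (.var x) (.const 1))))) (st N) (st (s.natVar y)) t ∧
      t ≤ M * (T + 9) + 5 := by
    intro M
    induction M with
    | zero =>
      intro N hN
      obtain rfl : N = s.natVar y := by omega
      refine ⟨_, Run.loopStop ?_, ?_⟩
      · simp [BExpr.Holds, NExpr.eval, hyN, (hfr (s.natVar y)).2]
      · simp [BExpr.cost, NExpr.cost]
    | succ M ih =>
      intro N hN
      obtain ⟨t, ht, htT⟩ := hP _ (hfr N).1
      obtain ⟨t', ht', htT'⟩ := ih (N + 1) (by omega)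
      have hstep : st (N + 1) = (P.exec (st N)).setNat x
          (NExpr.eval (P.exec (st N)) (.add (.var x) (.const 1))) := by
        simp [hst, NExpr.eval, exec_natVar P _ hx]
        congr 1
        exact congrArg (· + 1) (hfr N).2.symm
      rw [hstep] at ht'
      refine ⟨_, Run.loopStep ?_ (Run.seq ht (Run.setNat _ _ _)) ht', ?_⟩
      · simp only [BExpr.Holds, NExpr.eval, hyN, (hfr N).2]
        omega
      · simp only [BExpr.cost, NExpr.cost, Nat.add_mul]
        omega
  obtain ⟨t, ht, hT⟩ := key _ 0 rfl
  exact ⟨_, Run.seq (Run.setNat _ _ _) ht, by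
    change t ≤ s.natVar y * (T + 9) + 5 at hT
    simp only [NExpr.cost]
    omega⟩

/-- Nested loops multiply their limits. The variable `z` is singled out so that a single exponential
limit `E` can be kept apart from the polynomial limits, bounded by `K`. All loop limits keep their
initial values throughout, by `ok`. -/
theorem run_compile {L : List ℕ} {z K E : ℕ} (hK : 1 ≤ K) (hE : 1 ≤ E) {P : FProg} {s : Mem}
    (h : P.ok L = true) (hL : ∀ y ∈ L, s.natVar y ≤ if y = z then E else K) :
    ∃ t, Run P.compile s (P.exec s) t ∧ t ≤ P.coef * K ^ P.depth z * E ^ P.expDepth z := by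
  have one_le : ∀ a b : ℕ, 1 ≤ K ^ a * E ^ b := fun a b =>
    Nat.mul_pos (Nat.pow_pos hK) (Nat.pow_pos hE)
  have mono : ∀ {c a b a' b' : ℕ}, a ≤ a' → b ≤ b' →
      c * K ^ a * E ^ b ≤ c * K ^ a' * E ^ b' := fun h h' =>
    Nat.mul_le_mul (Nat.mul_le_mul le_rfl (Nat.pow_le_pow_right hK h)) (Nat.pow_le_pow_right hE h')
  induction P generalizing s with
  | skip => exact ⟨_, Run.skip _, by simp [coef, depth, expDepth]⟩
  | setN x e => exact ⟨_, Run.setNat _ _ _, by simp [coef, depth, expDepth]⟩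
  | stN a i e => exact ⟨_, Run.storeNat _ _ _ _, by simp [coef, depth, expDepth]⟩
  | setR x e => exact ⟨_, Run.setReal _ _ _, by simp [coef, depth, expDepth]⟩
  | stR a i e => exact ⟨_, Run.storeReal _ _ _ _, by simp [coef, depth, expDepth]⟩
  | seq P Q ihP ihQ =>
    simp only [ok, Bool.and_eq_true] at h
    obtain ⟨t, ht, hT⟩ := ihP h.1 hL
    obtain ⟨t', ht', hT'⟩ := ihQ (s := P.exec s) h.2 fun y hy => by
      rw [exec_natVar P _ (wn_eq_false_of_ok h.1 hy)]
      exact hL y hy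
    refine ⟨_, Run.seq ht ht', ?_⟩
    simp only [coef, depth, expDepth, Nat.add_mul]
    exact Nat.add_le_add (hT.trans (mono (le_max_left _ _) (le_max_left _ _)))
      (hT'.trans (mono (le_max_right _ _) (le_max_right _ _)))
  | ite b P Q ihP ihQ =>
    simp only [ok, Bool.and_eq_true] at h
    obtain ⟨t, ht, hT⟩ := ihP h.1 hL
    obtain ⟨t', ht', hT'⟩ := ihQ h.2 hL
    have hP := hT.trans (mono (le_max_left _ (Q.depth z)) (le_max_left _ (Q.expDepth z)))
    have hQ := hT'.trans (mono (le_max_right (P.depth z) _) (le_max_right (P.expDepth z) _))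
    have hb := Nat.mul_le_mul (le_refl (b.cost + 1))
      (one_le (max (P.depth z) (Q.depth z)) (max (P.expDepth z) (Q.expDepth z)))
    simp only [coef, depth, expDepth, Nat.add_mul, exec, compile] at *
    simp only [← mul_assoc] at hb
    by_cases hbs : b.Holds s
    · rw [if_pos hbs]
      exact ⟨_, Run.iteTrue hbs ht, by linarith⟩
    · rw [if_neg hbs]
      exact ⟨_, Run.iteFalse hbs ht', by linarith⟩
  | forN x y P ih =>
    simp only [ok, Bool.and_eq_true, Bool.not_eq_true'] at h
    obtain ⟨⟨⟨hxL, hyL⟩, hxP⟩, hP⟩ := h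
    have hyL' : y ∈ L := by simpa using hyL
    have hxy : x ≠ y := by
      rintro rfl
      simp [hyL'] at hxL
    obtain ⟨t, ht, hT⟩ := run_loop (s := s) hxy hxP (wn_eq_false_of_ok hP hyL')
      (T := P.coef * K ^ P.depth z * E ^ P.expDepth z) fun s' hs' => ih hP fun u hu => by
        have hux : x ≠ u := by
          rintro rfl
          simp [hu] at hxL
        rw [hs'.nv u (by simp [wn, hux, wn_eq_false_of_ok hP hu])]
        exact hL u hu
    refine ⟨t, ht, hT.trans ?_⟩
    have h1 := one_le (P.depth z) (P.expDepth z)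
    have hy := hL y hyL'
    simp only [coef, depth, expDepth, Nat.mul_assoc] at *
    set A := K ^ P.depth z * E ^ P.expDepth z with hA
    -- The constants 9 per pass and 7 per loop from `run_loop` are absorbed in the 16 of `coef`, as
    -- both `N` and `A` are at least 1.
    have hmain : ∀ N, 1 ≤ N → s.natVar y ≤ N →
        s.natVar y * (P.coef * A + 9) + 7 ≤ (P.coef + 16) * (N * A) := by
      intro N hN hyN
      have h2 : N * 1 ≤ N * A := Nat.mul_le_mul le_rfl h1
      have h3 : s.natVar y * (P.coef * A + 9) ≤ N * (P.coef * A + 9) :=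
        Nat.mul_le_mul hyN le_rfl
      nlinarith
    split_ifs with hz
    · rw [if_pos hz] at hy
      refine (hmain E hE hy).trans (le_of_eq ?_)
      rw [hA, pow_succ]; ring
    · rw [if_neg hz] at hy
      refine (hmain K hK hy).trans (le_of_eq ?_)
      rw [hA, pow_succ]; ring

end FProg

end LocalPartition

namespace LocalPartition

open Finset Polynomial

open scoped Classical

/-! ### The min-plus recursion over a tree decomposition -/

/-- The min-plus semiring; its addition is the minimum, its multiplication the sum of reals. -/
abbrev MinPlus := Tropical (WithTop ℝ)

/-- A real number as an element of the min-plus semiring. -/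
noncomputable def mp (r : ℝ) : MinPlus := Tropical.trop (r : WithTop ℝ)

theorem mp_add (r t : ℝ) : mp (r + t) = mp r * mp t := by
  simp [mp, ← Tropical.trop_add]

theorem mp_zero : mp 0 = 1 := rfl

/-- The contribution of a pair of adjacent vertices to the value of a vertex set. -/
noncomputable def pairWeight (a₁ a₂ : ℝ) (X : Finset ℕ) (e : ℕ × ℕ) : ℝ :=
  if e.1 ∈ X then (if e.2 ∈ X then a₁ else a₂) else (if e.2 ∈ X then a₂ else 0)

theorem pairWeight_congr {a₁ a₂ : ℝ} {X Y : Finset ℕ} {e : ℕ × ℕ} (h₁ : e.1 ∈ X ↔ e.1 ∈ Y)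
    (h₂ : e.2 ∈ X ↔ e.2 ∈ Y) : pairWeight a₁ a₂ X e = pairWeight a₁ a₂ Y e := by
  simp only [pairWeight, h₁, h₂]

/-- The generating function, by size, of the best choices of a subset of `U` given the choice `Y`
outside `U`, where the edges that meet `U` count. -/
noncomputable def partialSum (a₁ a₂ : ℝ) (E : Finset (ℕ × ℕ)) (U Y : Finset ℕ) : MinPlus[X] :=
  ∑ Z ∈ U.powerset, monomial Z.card
    (mp (∑ e ∈ E with e.1 ∈ U ∨ e.2 ∈ U, pairWeight a₁ a₂ (Y ∪ Z) e))

theorem partialSum_empty (a₁ a₂ : ℝ) (E : Finset (ℕ × ℕ)) (Y : Finset ℕ) :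
    partialSum a₁ a₂ E ∅ Y = 1 := by
  simp [partialSum, mp_zero]

/-- A choice in `U ∪ N` is a choice `W` in `N` followed by one in `U`. The edges concerned split
into those meeting `U`, which the inner sum takes care of, and those meeting `N` but not `U`, whose
weight depends on `Y ∪ W` alone. -/
theorem partialSum_union (a₁ a₂ : ℝ) (E : Finset (ℕ × ℕ)) {U N : Finset ℕ} (Y : Finset ℕ)
    (hUN : Disjoint U N) :
    partialSum a₁ a₂ E (U ∪ N) Y = ∑ W ∈ N.powerset, monomial W.card
      (mp (∑ e ∈ E with (e.1 ∈ N ∨ e.2 ∈ N) ∧ e.1 ∉ U ∧ e.2 ∉ U, pairWeight a₁ a₂ (Y ∪ W) e)) *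
        partialSum a₁ a₂ E U (Y ∪ W) := by
  simp only [partialSum, mul_sum, monomial_mul_monomial, ← mp_add]
  rw [← sum_product']
  symm
  refine sum_bij' (fun x _ => x.1 ∪ x.2) (fun Z _ => (Z ∩ N, Z ∩ U)) ?_ ?_ ?_ ?_ ?_
  · rintro ⟨W, Z⟩ h
    simp only [mem_product, mem_powerset] at h ⊢
    exact union_subset (h.1.trans subset_union_right) (h.2.trans subset_union_left)
  · intro Z _
    simp
  · rintro ⟨W, Z⟩ h
    simp only [mem_product, mem_powerset] at h
    have h1 := fun v => @h.1 v
    have h2 := fun v => @h.2 v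
    have h3 := fun v => @disjoint_left.1 hUN v
    ext v <;> simp <;> grind
  · intro Z h
    simp only [mem_powerset] at h
    have h1 := fun v => @h v
    ext v
    simp only [mem_union, mem_inter]
    grind
  · rintro ⟨W, Z⟩ h
    simp only [mem_product, mem_powerset] at h
    have hd : Disjoint W Z := (hUN.symm.mono h.1 h.2)
    rw [card_union_of_disjoint hd]
    congr 2
    have : (E.filter fun e => e.1 ∈ U ∪ N ∨ e.2 ∈ U ∪ N) =
        (E.filter fun e => (e.1 ∈ N ∨ e.2 ∈ N) ∧ e.1 ∉ U ∧ e.2 ∉ U) ∪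
          (E.filter fun e => e.1 ∈ U ∨ e.2 ∈ U) := by
      ext e
      simp only [mem_filter, mem_union]
      tauto
    rw [this, sum_union]
    · congr 1
      · refine sum_congr rfl fun e he => ?_
        simp only [mem_filter] at he
        have h1 : e.1 ∉ Z := fun h' => he.2.2.1 (h.2 h')
        have h2 : e.2 ∉ Z := fun h' => he.2.2.2 (h.2 h')
        exact pairWeight_congr (by simp [h1]) (by simp [h2])
      · refine sum_congr rfl fun e he => ?_
        rw [union_assoc]
    · rw [disjoint_filter]
      tauto

/-- The table that a node with bag `Bc` hands over to its parent with bag `Bp`, when `F` is the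
product of the tables of its children. -/
noncomputable def message (a₁ a₂ : ℝ) (E : Finset (ℕ × ℕ)) (Bc Bp : Finset ℕ)
    (F : Finset ℕ → MinPlus[X]) (R : Finset ℕ) : MinPlus[X] :=
  ∑ S ∈ Bc.powerset with S ∩ Bp = R, monomial (S \ Bp).card
    (mp (∑ e ∈ E with (e.1 ∈ Bc ∧ e.2 ∈ Bc) ∧ ¬ (e.1 ∈ Bp ∧ e.2 ∈ Bp), pairWeight a₁ a₂ S e)) *
      F S

/-- The subsets of `Bc` with the prescribed trace on `Bp` differ only in `Bc \ Bp`, so `S \ Bp` can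
serve as summation variable. This brings the message into the shape of `partialSum_union`. -/
theorem message_eq (a₁ a₂ : ℝ) (E : Finset (ℕ × ℕ)) (Bc Bp : Finset ℕ)
    (F : Finset ℕ → MinPlus[X]) {Y : Finset ℕ} (hY : Disjoint Y (Bc \ Bp)) :
    message a₁ a₂ E Bc Bp F (Y ∩ Bc ∩ Bp) = ∑ W ∈ (Bc \ Bp).powerset, monomial W.card
      (mp (∑ e ∈ E with (e.1 ∈ Bc ∧ e.2 ∈ Bc) ∧ ¬ (e.1 ∈ Bp ∧ e.2 ∈ Bp),
        pairWeight a₁ a₂ (Y ∪ W) e)) * F ((Y ∪ W) ∩ Bc) := by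
  have hY' := fun v => @disjoint_left.1 hY v
  simp only [mem_sdiff, not_and, not_not] at hY'
  rw [message]
  refine sum_bij' (fun S _ => S \ Bp) (fun W _ => (Y ∩ Bc) ∪ W) ?_ ?_ ?_ ?_ ?_
  · intro S hS
    simp only [mem_filter, mem_powerset] at hS ⊢
    exact sdiff_subset_sdiff hS.1 (Subset.refl _)
  · intro W hW
    simp only [mem_filter, mem_powerset] at hW ⊢
    have h1 := fun v => @hW v
    refine ⟨union_subset inter_subset_right (hW.trans sdiff_subset), ?_⟩
    ext v
    specialize h1 v
    simp only [mem_inter, mem_union, mem_sdiff] at *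
    tauto
  · intro S hS
    simp only [mem_filter, mem_powerset] at hS
    ext v
    have h1 := @hS.1 v
    have h2 := Finset.ext_iff.1 hS.2 v
    specialize hY' v
    simp only [mem_inter, mem_union, mem_sdiff] at *
    tauto
  · intro W hW
    simp only [mem_powerset] at hW
    ext v
    have h1 := @hW v
    specialize hY' v
    simp only [mem_inter, mem_union, mem_sdiff] at *
    tauto
  · intro S hS
    simp only [mem_filter, mem_powerset] at hS
    have hmem : ∀ v ∈ Bc, (v ∈ S ↔ v ∈ Y ∪ S \ Bp) := by
      intro v hv
      have h2 := Finset.ext_iff.1 hS.2 v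
      specialize hY' v
      simp only [mem_inter, mem_union, mem_sdiff] at *
      tauto
    congr 3
    · refine sum_congr rfl fun e he => ?_
      simp only [mem_filter] at he
      exact pairWeight_congr (hmem _ he.2.1.1) (hmem _ he.2.1.2)
    · ext v
      have h1 := @hS.1 v
      have h2 := hmem v
      rw [mem_inter]
      tauto

/-- The data of the recursion: numbers of vertices and nodes, edges, tree and bags. -/
structure Decomp where
  n : ℕ
  m : ℕ
  E : Finset (ℕ × ℕ)
  T : ℕ → ℕ → Prop
  B : ℕ → Finset ℕ
  a₁ : ℝ
  a₂ : ℝ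

/-! ### Elimination of the nodes of the tree, leaf by leaf -/

namespace Decomp

variable (D : Decomp)

/-- The nodes not yet processed, if `q` is `0` on these and otherwise one more than the parent. -/
noncomputable def alive (q : ℕ → ℕ) : Finset ℕ := {i ∈ range (D.m + 1) | q i = 0}

/-- The vertices that occur in no bag of an unprocessed node. -/
noncomputable def gone (q : ℕ → ℕ) : Finset ℕ := {v ∈ range D.n | ∀ i ∈ D.alive q, v ∉ D.B i}

/-- The product of the tables `M` of the children of `c`. -/
noncomputable def childProd (q : ℕ → ℕ) (M : ℕ → Finset ℕ → MinPlus[X]) (c : ℕ)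
    (S : Finset ℕ) : MinPlus[X] :=
  ∏ d ∈ range D.m with q d = c + 1, M d (S ∩ D.B d)

/-- The table computed at node `c` with parent `p`. -/
noncomputable def newTable (q : ℕ → ℕ) (M : ℕ → Finset ℕ → MinPlus[X]) (c p : ℕ) :
    Finset ℕ → MinPlus[X] :=
  message D.a₁ D.a₂ D.E (D.B c) (D.B p) (D.childProd q M c)

/-- The invariant of the recursion. -/
structure Inv (q : ℕ → ℕ) (M : ℕ → Finset ℕ → MinPlus[X]) : Prop where
  root : q D.m = 0
  edge : ∀ e ∈ D.E, (∃ i ∈ D.alive q, e.1 ∈ D.B i) → (∃ i ∈ D.alive q, e.2 ∈ D.B i) →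
    ∃ i ∈ D.alive q, e.1 ∈ D.B i ∧ e.2 ∈ D.B i
  conn : ∀ v, ∀ i ∈ D.alive q, ∀ j ∈ D.alive q, v ∈ D.B i → v ∈ D.B j →
    Relation.ReflTransGen (fun a b => D.T a b ∧ b ∈ D.alive q ∧ v ∈ D.B b) i j
  child : ∀ d < D.m, ∀ a ∈ D.alive q, q d = a + 1 → ∀ v ∈ D.B d, ∀ i ∈ D.alive q,
    v ∈ D.B i → v ∈ D.B a
  sum : ∀ Y, Disjoint Y (D.gone q) → partialSum D.a₁ D.a₂ D.E (D.gone q) Y =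
    ∏ a ∈ D.alive q, D.childProd q M a Y
  zero : ∀ d ∈ D.alive q, M d = 0

variable {D} {q : ℕ → ℕ} {M : ℕ → Finset ℕ → MinPlus[X]}

theorem mem_alive {i : ℕ} : i ∈ D.alive q ↔ i ≤ D.m ∧ q i = 0 := by
  simp [alive]

theorem alive_update {c : ℕ} (p : ℕ) :
    D.alive (Function.update q c (p + 1)) = (D.alive q).erase c := by
  ext i
  by_cases h : i = c <;> simp [mem_alive, h]

/-- Removing a leaf from a connected set of nodes. -/
theorem reflTransGen_erase {T : ℕ → ℕ → Prop} (hsymm : ∀ i j, T i j → T j i)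
    (hirr : ∀ i, ¬ T i i) {s : ℕ → Prop} {c p i j : ℕ} (huniq : ∀ a, s a → T c a → a = p)
    (hs : s i) (hi : i ≠ c) (hj : j ≠ c) (h : Relation.ReflTransGen (fun a b => T a b ∧ s b) i j) :
    Relation.ReflTransGen (fun a b => T a b ∧ b ≠ c ∧ s b) i j := by
  -- A walk enters `c` from `p` and can leave it only to `p`, so visits to `c` can be cut out. The
  -- induction therefore also has to say what is reachable while the walk sits at `c`.
  suffices s j ∧ (j ≠ c → Relation.ReflTransGen (fun a b => T a b ∧ b ≠ c ∧ s b) i j) ∧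
      (j = c → ∀ a, s a → T c a → Relation.ReflTransGen (fun a b => T a b ∧ b ≠ c ∧ s b) i a) from
    this.2.1 hj
  clear hj
  induction h with
  | refl => exact ⟨hs, fun _ => .refl, fun h => absurd h hi⟩
  | @tail a b _ hab ih =>
    obtain ⟨hsa, h1, h2⟩ := ih
    refine ⟨hab.2, fun hb => ?_, fun hb x hx hcx => ?_⟩
    · by_cases ha : a = c
      · subst ha
        exact h2 rfl b hab.2 hab.1
      · exact (h1 ha).tail ⟨hab.1, hb, hab.2⟩
    · subst hb
      have ha : a ≠ b := by
        rintro rfl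
        exact hirr _ hab.1
      rw [huniq x hx hcx, ← huniq a hsa (hsymm _ _ hab.1)]
      exact h1 ha

/-- The unprocessed nodes whose bags contain `v` are connected, and the first step from `c` towards
another of them can only lead to `p`. -/
theorem Inv.mem_parent (h : D.Inv q M) {c p : ℕ} (hc : c ∈ D.alive q)
    (huniq : ∀ i ∈ D.alive q, D.T c i → i = p) {v i : ℕ} (hv : v ∈ D.B c) (hi : i ∈ D.alive q)
    (hic : i ≠ c) (hvi : v ∈ D.B i) : v ∈ D.B p := by
  rcases Relation.ReflTransGen.cases_head (h.conn v c hc i hi hv hvi) with h' | ⟨a, ha, -⟩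
  · exact absurd h'.symm hic
  · rw [← huniq a ha.2.1 ha.1]
    exact ha.2.2

/-- Processing a leaf `c` eliminates exactly the vertices of `N = B c \ B p`, since by
`Inv.mem_parent` they lie in no other unprocessed bag. In the expansion of `partialSum` over `W ⊆
N`, the choice `W` influences only the factor that belongs to `c`. The other factors come out of the
sum, and the sum that remains is the new table of `c`. -/
theorem Inv.step (h : D.Inv q M) (hsymm : ∀ i j, D.T i j → D.T j i) (hirr : ∀ i, ¬ D.T i i)
    (hB : ∀ i, D.B i ⊆ range D.n)
    (hE : ∀ e ∈ D.E, e.1 < D.n ∧ e.2 < D.n) {c p : ℕ} (hcm : c < D.m) (hc : c ∈ D.alive q)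
    (hp : p ∈ D.alive q) (hpc : p ≠ c) (huniq : ∀ i ∈ D.alive q, D.T c i → i = p) :
    D.Inv (Function.update q c (p + 1))
      (Function.update M c fun R => M c R + D.newTable q M c p R) := by
  have hpar := fun {v i} => h.mem_parent hc huniq (v := v) (i := i)
  have hqc : q c = 0 := (mem_alive.1 hc).2
  set N := D.B c \ D.B p with hN
  have hgone : D.gone (Function.update q c (p + 1)) = D.gone q ∪ N := by
    ext v
    simp only [gone, mem_filter, mem_union, alive_update, hN, mem_sdiff, mem_erase]
    constructor
    · rintro ⟨hv, h1⟩
      by_cases hvc : v ∈ D.B c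
      · exact Or.inr ⟨hvc, h1 p ⟨hpc, hp⟩⟩
      · refine Or.inl ⟨hv, fun i hi => ?_⟩
        by_cases hic : i = c
        · rwa [hic]
        · exact h1 i ⟨hic, hi⟩
    · rintro (⟨hv, h1⟩ | ⟨hv, h1⟩)
      · exact ⟨hv, fun i hi => h1 i hi.2⟩
      · exact ⟨hB c hv, fun i hi hvi => h1 (hpar hv hi.2 hi.1 hvi)⟩
  have hdisj : Disjoint (D.gone q) N := by
    rw [disjoint_left]
    intro v hv hvN
    exact (mem_filter.1 hv).2 c hc (mem_sdiff.1 hvN).1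
  constructor
  · rw [Function.update_of_ne (by omega)]
    exact h.root
  · intro e he h1 h2
    rw [alive_update] at *
    obtain ⟨i, hi, hi1⟩ := h1
    obtain ⟨j, hj, hj1⟩ := h2
    rw [mem_erase] at hi hj
    obtain ⟨a, ha, ha1, ha2⟩ := h.edge e he ⟨i, hi.2, hi1⟩ ⟨j, hj.2, hj1⟩
    -- If the common bag is the one that disappears, both ends also lie in other unprocessed bags
    -- and hence in `B p`, which replaces it.
    by_cases hac : a = c
    · subst hac
      exact ⟨p, mem_erase.2 ⟨hpc, hp⟩, hpar ha1 hi.2 hi.1 hi1, hpar ha2 hj.2 hj.1 hj1⟩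
    · exact ⟨a, mem_erase.2 ⟨hac, ha⟩, ha1, ha2⟩
  · intro v i hi j hj hvi hvj
    rw [alive_update, mem_erase] at *
    refine Relation.ReflTransGen.mono ?_ _ _ (reflTransGen_erase (s := fun b => b ∈ D.alive q ∧ v ∈ D.B b) hsymm hirr
      (fun a ha hca => huniq a ha.1 hca) ⟨hi.2, hvi⟩ hi.1 hj.1
      (h.conn v i hi.2 j hj.2 hvi hvj))
    intro a b hab
    exact ⟨hab.1, mem_erase.2 ⟨hab.2.1, hab.2.2.1⟩, hab.2.2.2⟩
  · intro d hd a ha hda v hv i hi hvi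
    rw [alive_update, mem_erase] at *
    by_cases hdc : d = c
    · subst hdc
      simp only [Function.update_self, Nat.add_right_cancel_iff] at hda
      subst hda
      exact hpar hv hi.2 hi.1 hvi
    · rw [Function.update_of_ne hdc] at hda
      exact h.child d hd a ha.2 hda v hv i hi.2 hvi
  · intro Y hY
    rw [hgone, disjoint_union_right] at hY
    rw [hgone, partialSum_union _ _ _ _ hdisj]
    -- Only the product at `p` changes: it gains the child `c`, whose table was zero (all entries
    -- infinite) before and so equals the message now.
    have hnew : ∀ a ∈ (D.alive q).erase c,
        D.childProd (Function.update q c (p + 1))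
          (Function.update M c fun R => M c R + D.newTable q M c p R) a Y =
        D.childProd q M a Y * if a = p then D.newTable q M c p (Y ∩ D.B c) else 1 := by
      intro a ha
      simp only [childProd]
      have h1 : ∏ d ∈ range D.m with q d = a + 1,
          Function.update M c (fun R => M c R + D.newTable q M c p R) d (Y ∩ D.B d) =
          ∏ d ∈ range D.m with q d = a + 1, M d (Y ∩ D.B d) := by
        refine prod_congr rfl fun d hd => ?_
        rw [Function.update_of_ne]
        rintro rfl
        simp [hqc] at hd
      by_cases hap : a = p
      · subst hap
        have : ((range D.m).filter fun d => Function.update q c (a + 1) d = a + 1) =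
            insert c ((range D.m).filter fun d => q d = a + 1) := by
          ext d
          by_cases hd : d = c
          · simp [hd, hcm]
          · simp [hd]
        rw [this, prod_insert (by simp [hqc]), h1, Function.update_self, h.zero c hc]
        simp [mul_comm]
      · have : ((range D.m).filter fun d => Function.update q c (p + 1) d = a + 1) =
            ((range D.m).filter fun d => q d = a + 1) := by
          ext d
          by_cases hd : d = c
          · simp [hd, hqc, Ne.symm hap]
          · simp [hd]
        rw [this, h1]
        simp [hap]
    rw [alive_update, prod_congr rfl hnew, prod_mul_distrib, prod_ite_eq' _ p,
      if_pos (mem_erase.2 ⟨hpc, hp⟩)]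
    have hYB : Y ∩ D.B c = Y ∩ D.B c ∩ D.B p := by
      ext v
      have := @disjoint_left.1 hY.2 v
      simp only [hN, mem_sdiff, mem_inter] at *
      tauto
    rw [hYB, newTable, message_eq _ _ _ _ _ _ hY.2, ← hN, mul_sum]
    refine sum_congr rfl fun W hW => ?_
    rw [mem_powerset] at hW
    have hWd : Disjoint (Y ∪ W) (D.gone q) :=
      disjoint_union_left.2 ⟨hY.1, (hdisj.mono_right hW).symm⟩
    rw [h.sum _ hWd, ← mul_prod_erase _ _ hc]
    -- The edges that the expansion assigns to `N` are those charged to `c`: such an edge lies in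
    -- some unprocessed bag, and any such bag other than `B c` would put its end in `N` into `B p`.
    have hedges : (D.E.filter fun e => (e.1 ∈ N ∨ e.2 ∈ N) ∧ e.1 ∉ D.gone q ∧ e.2 ∉ D.gone q) =
        (D.E.filter fun e => (e.1 ∈ D.B c ∧ e.2 ∈ D.B c) ∧ ¬ (e.1 ∈ D.B p ∧ e.2 ∈ D.B p)) := by
      refine filter_congr fun e he => ?_
      have hg : ∀ v, v ∈ D.B c → v ∉ D.gone q := fun v hv hv' =>
        (mem_filter.1 hv').2 c hc hv
      constructor
      · rintro ⟨h1, h2, h3⟩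
        have halive : ∀ v, v ∉ D.gone q → v ∈ range D.n → ∃ i ∈ D.alive q, v ∈ D.B i := by
          intro v hv hvn
          by_contra! hcon
          exact hv (mem_filter.2 ⟨hvn, hcon⟩)
        obtain ⟨a, ha, ha1, ha2⟩ := h.edge e he (halive _ h2 (mem_range.2 (hE e he).1))
          (halive _ h3 (mem_range.2 (hE e he).2))
        have hac : a = c := by
          by_contra hac
          rcases h1 with h1 | h1
          · exact (mem_sdiff.1 h1).2 (hpar (mem_sdiff.1 h1).1 ha hac ha1)
          · exact (mem_sdiff.1 h1).2 (hpar (mem_sdiff.1 h1).1 ha hac ha2)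
        subst hac
        refine ⟨⟨ha1, ha2⟩, fun h4 => ?_⟩
        rcases h1 with h1 | h1
        · exact (mem_sdiff.1 h1).2 h4.1
        · exact (mem_sdiff.1 h1).2 h4.2
      · rintro ⟨⟨h1, h2⟩, h3⟩
        refine ⟨?_, hg _ h1, hg _ h2⟩
        simp only [hN, mem_sdiff]
        tauto
    rw [hedges]
    -- A vertex of `W` in the bag of a child of `a` would lie in `B a` and then in `B p`, contrary
    -- to `W ⊆ N`.
    have hrest : ∀ a ∈ (D.alive q).erase c, D.childProd q M a (Y ∪ W) = D.childProd q M a Y := by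
      intro a ha
      rw [mem_erase] at ha
      refine prod_congr rfl fun d hd => ?_
      simp only [mem_filter, mem_range] at hd
      congr 1
      ext v
      simp only [mem_inter, mem_union]
      constructor
      · rintro ⟨hv | hv, hvd⟩
        · exact ⟨hv, hvd⟩
        · exfalso
          have hvN := mem_sdiff.1 (hW hv)
          have hva := h.child d hd.1 a ha.2 hd.2 v hvd c hc hvN.1
          exact hvN.2 (hpar hvN.1 ha.2 ha.1 hva)
      · exact fun hv => ⟨Or.inl hv.1, hv.2⟩
    rw [prod_congr rfl hrest]
    -- Vertices of `Y ∪ W` are not eliminated; if one is in the bag of a child of `c`, it occurs in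
    -- an unprocessed bag and therefore in `B c`.
    have hown : D.childProd q M c ((Y ∪ W) ∩ D.B c) = D.childProd q M c (Y ∪ W) := by
      refine prod_congr rfl fun d hd => ?_
      simp only [mem_filter, mem_range] at hd
      congr 1
      ext v
      simp only [mem_inter]
      refine ⟨fun hv => ⟨hv.1.1, hv.2⟩, fun hv => ⟨⟨hv.1, ?_⟩, hv.2⟩⟩
      have hg := disjoint_left.1 hWd hv.1
      simp only [gone, mem_filter, not_and, not_forall, not_not] at hg
      obtain ⟨i, hi, hvi⟩ := hg (hB d hv.2)
      exact h.child d hd.1 c hc hd.2 v hv.2 i hi hvi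
    rw [hown]
    ring
  · intro d hd
    rw [alive_update, mem_erase] at hd
    rw [Function.update_of_ne hd.1]
    exact h.zero d hd.2

/-- The start of the recursion. -/
theorem Inv.init (hcover : ∀ v < D.n, ∃ i ≤ D.m, v ∈ D.B i)
    (hedge : ∀ e ∈ D.E, ∃ i ≤ D.m, e.1 ∈ D.B i ∧ e.2 ∈ D.B i)
    (hconn : ∀ v i j, v ∈ D.B i → v ∈ D.B j →
      Relation.ReflTransGen (fun a b => D.T a b ∧ b ≤ D.m ∧ v ∈ D.B b) i j) :
    D.Inv (fun _ => 0) (fun _ _ => 0) := by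
  have hmem : ∀ i, i ∈ D.alive (fun _ => 0) ↔ i ≤ D.m := fun i => by simp [mem_alive]
  have hgone : D.gone (fun _ => 0) = ∅ := by
    ext v
    simp only [gone, mem_filter, mem_range, hmem, notMem_empty, iff_false, not_and, not_forall,
      not_not, exists_prop]
    exact hcover v
  refine ⟨rfl, fun e he _ _ => ?_, fun v i _ j _ hi hj => ?_, by simp, fun Y _ => ?_,
    fun d _ => rfl⟩
  · obtain ⟨i, hi, h⟩ := hedge e he
    exact ⟨i, (hmem i).2 hi, h⟩
  · simpa only [hmem] using hconn v i j hi hj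
  · simp [hgone, partialSum_empty, childProd]

/-- The end of the recursion: only the root, whose bag is empty, remains. -/
theorem Inv.newTable_root (h : D.Inv q M) (hroot : D.B D.m = ∅) (hq : ∀ d < D.m, q d ≠ 0) :
    D.newTable q M D.m D.m ∅ = partialSum D.a₁ D.a₂ D.E (range D.n) ∅ := by
  have halive : D.alive q = {D.m} := by
    ext i
    simp only [mem_alive, mem_singleton]
    refine ⟨fun hi => ?_, fun hi => by simp [hi, h.root]⟩
    by_contra hne
    exact hq i (by omega) hi.2
  have hgone : D.gone q = range D.n := by
    simp [gone, halive, hroot]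
  rw [← hgone, h.sum _ (disjoint_empty_left _), halive, prod_singleton, newTable, message, hroot]
  simp only [powerset_empty, filter_singleton]
  simp [mp_zero]

end Decomp

/-- Untropicalized, a sum is a minimum; sets of the wrong size contribute the tropical zero, which
is infinity and never at most `r`. -/
theorem untrop_coeff_partialSum_le {a₁ a₂ : ℝ} {E : Finset (ℕ × ℕ)} {n k : ℕ} {r : ℝ}
    (hE : ∀ e ∈ E, e.1 < n ∧ e.2 < n) :
    Tropical.untrop ((partialSum a₁ a₂ E (range n) ∅).coeff k) ≤ (r : WithTop ℝ) ↔
      ∃ Z ⊆ range n, Z.card = k ∧ ∑ e ∈ E, pairWeight a₁ a₂ Z e ≤ r := by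
  have hall : (E.filter fun e => e.1 ∈ range n ∨ e.2 ∈ range n) = E :=
    filter_true_of_mem fun e he => Or.inl (mem_range.2 (hE e he).1)
  simp only [partialSum, finsetSum_coeff, coeff_monomial, empty_union, hall]
  rw [Finset.untrop_sum', Finset.inf_le_iff (WithTop.coe_lt_top r)]
  simp only [mem_powerset, Function.comp]
  refine exists_congr fun Z => and_congr_right fun _ => ?_
  split_ifs with hk
  · simp only [hk, mp, Tropical.untrop_trop, WithTop.coe_le_coe, true_and]
  · simp [hk]

/-- The coefficients of a product in terms of finitely many coefficients of the factors. -/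
theorem coeff_mul_range {R : Type*} [CommSemiring R] (p q : R[X]) {n j : ℕ} (hj : j < n) :
    (p * q).coeff j = ∑ a ∈ range n, ∑ b ∈ range n,
      if j = a + b then p.coeff a * q.coeff b else 0 := by
  rw [coeff_mul, ← sum_product', ← sum_filter]
  refine sum_congr ?_ fun _ _ => rfl
  ext ⟨a, b⟩
  simp only [HasAntidiagonal.mem_antidiagonal, mem_filter, mem_product, mem_range]
  omega

end LocalPartition

namespace LocalPartition

open Finset Polynomial FProg

open scoped Classical

/-! ### Simulation of bounded-loop programs on tables -/

namespace FProg

section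

variable (s : Mem) (x y a : ℕ) (i e : NExpr) (r : RExpr) (b : BExpr) (P Q : FProg)

@[simp] theorem exec_skip : exec .skip s = s := rfl
@[simp] theorem exec_setN : exec (.setN x e) s = s.setNat x (e.eval s) := rfl
@[simp] theorem exec_stN : exec (.stN a i e) s = s.storeNat a (i.eval s) (e.eval s) := rfl
@[simp] theorem exec_setR : exec (.setR x r) s = s.setReal x (r.eval s) := rfl
@[simp] theorem exec_stR : exec (.stR a i r) s = s.storeReal a (i.eval s) (r.eval s) := rfl
@[simp] theorem exec_seq : exec (.seq P Q) s = Q.exec (P.exec s) := rfl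

@[simp] theorem exec_ite :
    exec (.ite b P Q) s = if b.Holds s then P.exec s else Q.exec s := rfl

variable {s b P Q}

theorem exec_ite_pos (h : b.Holds s) : exec (.ite b P Q) s = P.exec s := if_pos h

theorem exec_ite_neg (h : ¬ b.Holds s) : exec (.ite b P Q) s = Q.exec s := if_neg h

end

end FProg

/-- A table with values in the min-plus semiring: the natural number array tells which entries are
finite, the array of real numbers tells their values. -/
noncomputable def Mem.tab (s : Mem) (a i : ℕ) : MinPlus :=
  if s.natArr a i = 0 then 0 else mp (s.realArr a i)

theorem FProg.exec_tab (P : FProg) (s : Mem) {a : ℕ} (h : P.wa a = false := by rfl)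
    (h' : P.wra a = false := by rfl) : (P.exec s).tab a = s.tab a := by
  funext i
  rw [Mem.tab, Mem.tab, P.exec_natArr s h, P.exec_realArr s h']

theorem FProg.Frame.tab {P : FProg} {s s' : Mem} (h : Frame P s s') {a : ℕ}
    (h₁ : P.wa a = false := by rfl) (h₂ : P.wra a = false := by rfl) : s'.tab a = s.tab a := by
  funext i
  simp only [Mem.tab, h.na a h₁, h.ra a h₂]

@[simp] theorem Mem.setNat_tab (s : Mem) (x v a : ℕ) : (s.setNat x v).tab a = s.tab a := rfl

@[simp] theorem Mem.setReal_tab (s : Mem) (x : ℕ) (r : ℝ) (a : ℕ) :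
    (s.setReal x r).tab a = s.tab a := rfl

theorem mp_add_mp (r t : ℝ) : mp r + mp t = mp (min r t) :=
  (congrArg Tropical.trop (WithTop.coe_min r t)).symm

/-! Variables `0`, `1`, `2` are the input `n`, `m`, `k`; then come `n + 1` (`3`), the number of
rounds of the subset enumeration (`4`), the counters of rounds (`5`), nodes (`6`, and their parents
`7`), the degree of a node (`8`), an auxiliary counter (`9`), the counter of subsets (`10`), of
vertices (`11`, `12`), of children (`13`), of sizes (`14`, `15`), the address of a row in a table
(`16`), an index (`17`), a size (`18`), the carry (`19`) and a loop limit (`20`).  Arrays `0`, `1`,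
`2` are the input; then come powers of two (`3`), multiples of `n` (`4`) and of `m` (`5`), parents
plus one (`6`), and the current subset (`7`); tables `8`, `9`, `10` are the tables of the nodes and
two polynomials.  Real variable `3` is a value and `4` an argument. -/

/-- `e = 1` -/
def isOne (e : NExpr) : BExpr := .natEq e (.const 1)

/-- `e ≠ 0` -/
def isPos (e : NExpr) : BExpr := .not (.natEq e (.const 0))

/-- Entry of the bag matrix, for a node and a vertex given by variables. -/
def bagAt (i v : ℕ) : NExpr := .arr 2 (.add (.arr 4 (.var i)) (.var v))

/-- Address of a table entry with size given by variable `x`, in the row given by variable `16`. -/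
def addrAt (x : ℕ) : NExpr :=
  .add (.var 16) (.arr 3 (.add (.add (.var 0) (.add (.var 1) (.const 1))) (.var x)))

/-- Add (that is, take the minimum with) real variable `4` at index variable `17` of table `a`. -/
def relax (a : ℕ) : FProg :=
  .ite (.and (isPos (.arr a (.var 17))) (.realLe (.arr a (.var 17)) (.var 4))) .skip
    (.seq (.stN a (.var 17) (.const 1)) (.stR a (.var 17) (.var 4)))

/-- Tropical addition is the minimum, so a finite entry is kept if it is already at most the
argument, and any other entry is overwritten; in particular, an infinite one always is. -/
theorem relax_tab (a : ℕ) (s : Mem) (i : ℕ) : ((relax a).exec s).tab a i =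
    s.tab a i + if i = s.natVar 17 then mp (s.realVar 4) else 0 := by
  have hexec : (relax a).exec s = if s.natArr a (s.natVar 17) ≠ 0 ∧
      s.realArr a (s.natVar 17) ≤ s.realVar 4 then s else
      (s.storeNat a (s.natVar 17) 1).storeReal a (s.natVar 17) (s.realVar 4) := by
    rw [relax, exec_ite]
    exact if_congr Iff.rfl rfl rfl
  rw [hexec]
  by_cases h : s.natArr a (s.natVar 17) ≠ 0 ∧ s.realArr a (s.natVar 17) ≤ s.realVar 4
  · rw [if_pos h]
    by_cases hi : i = s.natVar 17
    · simp [Mem.tab, hi, h.1, mp_add_mp, h.2]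
    · simp [hi]
  · rw [if_neg h]
    by_cases hi : i = s.natVar 17
    · by_cases h0 : s.natArr a (s.natVar 17) = 0
      · simp [Mem.tab, hi, h0]
      · have : s.realVar 4 ≤ s.realArr a (s.natVar 17) := by
          by_contra hlt
          exact h ⟨h0, le_of_not_ge hlt⟩
        simp [Mem.tab, hi, h0, mp_add_mp, this]
    · simp [Mem.tab, hi]

/-- Make the first `n + 1` entries of table `a` infinite. -/
def clear (a : ℕ) : FProg := .forN 9 3 (.stN a (.var 9) (.const 0))

theorem clear_tab (a : ℕ) (s : Mem) {j : ℕ} (hj : j < s.natVar 3) :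
    ((clear a).exec s).tab a j = 0 := by
  refine forN_induct (I := fun i s' => ∀ j < i, s'.tab a j = 0) (by simp) ?_ j hj
  intro i s' _ _ hx ih j hj
  by_cases hji : j = i
  · simp [Mem.tab, NExpr.eval, hx, hji]
  · have := ih j (by omega)
    simpa [Mem.tab, NExpr.eval, hx, hji] using this

/-- No register of the input or of the precomputed data is overwritten. -/
def FProg.keeps (P : FProg) : Bool :=
  !P.wn 0 && !P.wn 1 && !P.wn 3 && !P.wn 4 && !P.wa 0 && !P.wa 1 && !P.wa 2 && !P.wa 3 &&
    !P.wa 4 && !P.wa 5 && !P.wr 0 && !P.wr 1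

/-- The input and the precomputed data. -/
structure Ctx (D : Decomp) (L : ℕ) (s : Mem) : Prop where
  n : s.natVar 0 = D.n
  m : s.natVar 1 = D.m
  n1 : s.natVar 3 = D.n + 1
  lim : s.natVar 4 = L
  adj : ∀ u < D.n, ∀ v < D.n, (v < u ∧ s.natArr 0 (s.natArr 4 u + v) = 1) ↔ (u, v) ∈ D.E
  tree : ∀ i < D.m, ∀ j < D.m, s.natArr 1 (s.natArr 5 i + j) = 1 ↔ D.T i j
  bag : ∀ i ≤ D.m, ∀ v < D.n, s.natArr 2 (s.natArr 4 i + v) = 1 ↔ v ∈ D.B i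
  pow : ∀ i ≤ 2 * D.n + D.m + 1, s.natArr 3 i = 2 ^ i
  a₁ : s.realVar 0 = D.a₁
  a₂ : s.realVar 1 = D.a₂

theorem Ctx.frame {D : Decomp} {L : ℕ} {s s' : Mem} (h : Ctx D L s) {P : FProg}
    (hf : Frame P s s') (hP : P.keeps = true := by rfl) : Ctx D L s' := by
  simp only [FProg.keeps, Bool.and_eq_true, Bool.not_eq_true'] at hP
  obtain ⟨⟨⟨⟨⟨⟨⟨⟨⟨⟨⟨h0, h1⟩, h3⟩, h4⟩, a0⟩, a1⟩, a2⟩, a3⟩, a4⟩, a5⟩, r0⟩, r1⟩ := hP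
  constructor
  · rw [hf.nv _ h0]; exact h.n
  · rw [hf.nv _ h1]; exact h.m
  · rw [hf.nv _ h3]; exact h.n1
  · rw [hf.nv _ h4]; exact h.lim
  · rw [hf.na _ a0, hf.na _ a4]; exact h.adj
  · rw [hf.na _ a1, hf.na _ a5]; exact h.tree
  · rw [hf.na _ a2, hf.na _ a4]; exact h.bag
  · rw [hf.na _ a3]; exact h.pow
  · rw [hf.rv _ r0]; exact h.a₁
  · rw [hf.rv _ r1]; exact h.a₂

theorem Ctx.exec {D : Decomp} {L : ℕ} {s : Mem} (h : Ctx D L s) (P : FProg)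
    (hP : P.keeps = true := by rfl) : Ctx D L (P.exec s) :=
  h.frame (P.exec_frame s) hP

/-- General properties of the data of the recursion. -/
structure Decomp.WF (D : Decomp) : Prop where
  symm : ∀ i j, D.T i j → D.T j i
  irrefl : ∀ i, ¬ D.T i i
  bag : ∀ i, D.B i ⊆ range D.n
  edge : ∀ e ∈ D.E, e.1 < D.n ∧ e.2 < D.n
  root : D.B D.m = ∅
  lt : ∀ i j, D.T i j → j < D.m
  leaf : ∀ A ⊆ range D.m, A.Nonempty → ∃ c ∈ A, {i ∈ A | D.T c i}.card ≤ 1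

/-- The current subset is `S`. -/
def Cur (D : Decomp) (S : Finset ℕ) (s : Mem) : Prop := ∀ v < D.n, s.natArr 7 v = 1 ↔ v ∈ S

/-- The beginning of the row for node `d` and subset `R`. -/
def rowAddr (D : Decomp) (d : ℕ) (R : Finset ℕ) : ℕ := 2 ^ (D.n + d) + ∑ v ∈ R, 2 ^ v

/-- The address of a table entry. -/
def addr (D : Decomp) (d : ℕ) (R : Finset ℕ) (j : ℕ) : ℕ :=
  rowAddr D d R + 2 ^ (D.n + (D.m + 1) + j)

/-- An address is a binary number whose digits occupy three separate zones: positions below `n` for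
the vertices of `R`, positions `n` to `n + m` for the node, and later ones for the size. Uniqueness
of binary expansions recovers each part. -/
theorem addr_injective {D : Decomp} {d d' j j' : ℕ} {R R' : Finset ℕ} (hd : d ≤ D.m)
    (hd' : d' ≤ D.m) (hR : R ⊆ range D.n) (hR' : R' ⊆ range D.n)
    (h : addr D d R j = addr D d' R' j') : d = d' ∧ R = R' ∧ j = j' := by
  have key : ∀ {d j : ℕ} {R : Finset ℕ}, d ≤ D.m → R ⊆ range D.n → addr D d R j =
      ∑ i ∈ insert (D.n + d) (insert (D.n + (D.m + 1) + j) R), 2 ^ i := by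
    intro d j R hd hR
    have hR' := fun v => @hR v
    simp only [mem_range] at hR'
    rw [sum_insert, sum_insert, addr, rowAddr]
    · ring
    · intro hmem
      have := hR' _ hmem
      omega
    · intro hmem
      rcases mem_insert.1 hmem with hmem | hmem
      · omega
      · have := hR' _ hmem
        omega
  rw [key hd hR, key hd' hR'] at h
  have hs := geomSum_injective (le_refl 2) h
  have hR1 := fun v => @hR v
  have hR1' := fun v => @hR' v
  simp only [mem_range] at hR1 hR1'
  have hmem := fun v => Finset.ext_iff.1 hs v
  simp only [mem_insert] at hmem
  refine ⟨?_, ?_, ?_⟩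
  · rcases (hmem (D.n + d)).1 (Or.inl rfl) with h1 | h1 | h1
    · omega
    · omega
    · have := hR1' _ h1
      omega
  · ext v
    constructor
    · intro hv
      have := hR1 v hv
      rcases (hmem v).1 (Or.inr (Or.inr hv)) with h1 | h1 | h1
      · omega
      · omega
      · exact h1
    · intro hv
      have := hR1' v hv
      rcases (hmem v).2 (Or.inr (Or.inr hv)) with h1 | h1 | h1
      · omega
      · omega
      · exact h1
  · rcases (hmem (D.n + (D.m + 1) + j)).1 (Or.inr (Or.inl rfl)) with h1 | h1 | h1
    · omega
    · omega
    · have := hR1' _ h1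
      omega

/-- Compute the beginning of the row for node variable `b` and the intersection of the current
subset with the bag of node variable `i`. -/
def computeRow (b i : ℕ) : FProg :=
  .seq (.setN 16 (.arr 3 (.add (.var 0) (.var b))))
    (.forN 12 0 (.ite (.and (isOne (.arr 7 (.var 12))) (isOne (bagAt i 12)))
      (.setN 16 (.add (.var 16) (.arr 3 (.var 12)))) .skip))

theorem computeRow_spec {D : Decomp} (hD : D.WF) {L : ℕ} {s : Mem} (hC : Ctx D L s)
    {S : Finset ℕ} (hS : Cur D S s) {b i d e : ℕ} (hb : s.natVar b = d)
    (hi : s.natVar i = e) (hd : d ≤ D.m) (he : e ≤ D.m) (hi12 : i ≠ 12) (hi16 : i ≠ 16) :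
    ((computeRow b i).exec s).natVar 16 = rowAddr D d (S ∩ D.B e) := by
  have hsum : ∑ v ∈ S ∩ D.B e, 2 ^ v = ∑ v ∈ range D.n, if v ∈ S ∩ D.B e then 2 ^ v else 0 := by
    rw [sum_ite_mem]
    congr 1
    exact (inter_eq_right.2 (inter_subset_right.trans (hD.bag e))).symm
  rw [computeRow, exec_seq, rowAddr, hsum]
  set s1 := exec (.setN 16 (.arr 3 (.add (.var 0) (.var b)))) s with hs1
  have hC1 : Ctx D L s1 := hC.exec _
  have h16 : s1.natVar 16 = 2 ^ (D.n + d) := by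
    simp [hs1, NExpr.eval, hC.n, hb, hC.pow _ (show D.n + d ≤ 2 * D.n + D.m + 1 by omega)]
  have hi1 : s1.natVar i = e := by simp [hs1, hi16, hi]
  rw [show range D.n = range (s1.natVar 0) by rw [hC1.n]]
  refine forN_induct (I := fun k s' => s'.natVar 16 =
    2 ^ (D.n + d) + ∑ v ∈ range k, if v ∈ S ∩ D.B e then 2 ^ v else 0) ?_ ?_
  · simp [h16]
  intro v s' hv hf hx ih
  rw [hC1.n] at hv
  have hC' : Ctx D L s' := hC1.frame hf
  have hcur : s'.natArr 7 v = 1 ↔ v ∈ S := by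
    rw [hf.na 7 rfl]
    exact hS v hv
  have hie : s'.natVar i = e := by
    rw [hf.nv i, hi1]
    simp [wn, hi12.symm, hi16.symm]
  have hbag := hC'.bag e he v hv
  rw [sum_range_succ, ← add_assoc, ← ih]
  simp only [isOne, bagAt, exec_ite, BExpr.Holds, NExpr.eval, hx, hie, hcur, hbag, exec_setN,
    exec_skip, mem_inter]
  split_ifs with h
  · simp [hC'.pow v (by omega)]
  · simp

/-- Put the contribution of a node itself to its table entry for the current subset into
table `9`. -/
def localPoly : FProg :=
  .seq (clear 9) <| .seq (.setN 18 (.const 0)) <| .seq (.setR 3 .zero) <|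
  .seq (.forN 11 0 (.ite (.and (isOne (.arr 7 (.var 11))) (.not (isOne (bagAt 7 11))))
    (.setN 18 (.add (.var 18) (.const 1))) .skip)) <|
  .seq (.forN 11 0 (.forN 12 0 (.ite
    (.and (.and (.natLe (.add (.var 12) (.const 1)) (.var 11))
        (isOne (.arr 0 (.add (.arr 4 (.var 11)) (.var 12)))))
      (.and (.and (isOne (bagAt 6 11)) (isOne (bagAt 6 12)))
        (.not (.and (isOne (bagAt 7 11)) (isOne (bagAt 7 12))))))
    (.ite (isOne (.arr 7 (.var 11)))
      (.ite (isOne (.arr 7 (.var 12))) (.setR 3 (.add (.var 3) (.var 0)))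
        (.setR 3 (.add (.var 3) (.var 1))))
      (.ite (isOne (.arr 7 (.var 12))) (.setR 3 (.add (.var 3) (.var 1))) .skip))
    .skip))) <|
  .seq (.stN 9 (.var 18) (.const 1)) (.stR 9 (.var 18) (.var 3))

/-- After clearing, the only finite entry among those of size up to `n` is the one at the number of
chosen vertices that the parent's bag does not contain. Its value is accumulated in a double loop
over vertices, where the condition `v < u` makes each edge count once. -/
theorem localPoly_spec {D : Decomp} (hD : D.WF) {L : ℕ} {s : Mem} (hC : Ctx D L s)
    {S : Finset ℕ} (hSn : S ⊆ range D.n) (hS : Cur D S s) {c p : ℕ} (hc : s.natVar 6 = c)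
    (hp : s.natVar 7 = p) (hcm : c ≤ D.m) (hpm : p ≤ D.m) {j : ℕ} (hj : j < D.n + 1) :
    (localPoly.exec s).tab 9 j = (monomial (S \ D.B p).card (mp (∑ e ∈ D.E with
      (e.1 ∈ D.B c ∧ e.2 ∈ D.B c) ∧ ¬ (e.1 ∈ D.B p ∧ e.2 ∈ D.B p),
        pairWeight D.a₁ D.a₂ S e))).coeff j := by
  simp only [localPoly, exec_seq]
  set s1 := (clear 9).exec s with hs1
  have ht1 : ∀ j < D.n + 1, s1.tab 9 j = 0 := fun j hj => clear_tab 9 s (by rwa [hC.n1])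
  set s2 := exec (.setR 3 .zero) (exec (.setN 18 (.const 0)) s1) with hs2
  have hC1 : Ctx D L s1 := hC.exec (clear 9)
  have hC2 : Ctx D L s2 := (hC1.exec (.setN 18 (.const 0))).exec (.setR 3 .zero)
  have e2 : s2.natArr 7 = s.natArr 7 ∧ s2.natVar 6 = c ∧ s2.natVar 7 = p ∧
      s2.natVar 18 = 0 ∧ s2.realVar 3 = 0 ∧ s2.tab 9 = s1.tab 9 := by
    refine ⟨exec_natArr (clear 9) s, ?_, ?_, by simp [hs2, NExpr.eval],
      by simp [hs2, RExpr.eval], rfl⟩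
    · rw [← hc]; exact exec_natVar (clear 9) s
    · rw [← hp]; exact exec_natVar (clear 9) s
  clear_value s2
  obtain ⟨x2, c2, p2, n2, r2, t2⟩ := e2
  set A : FProg := .forN 11 0 (.ite (.and (isOne (.arr 7 (.var 11))) (.not (isOne (bagAt 7 11))))
    (.setN 18 (.add (.var 18) (.const 1))) .skip) with hA
  have hcard : (A.exec s2).natVar 18 = (S \ D.B p).card := by
    have : (S \ D.B p).card = ∑ v ∈ range D.n, if v ∈ S \ D.B p then 1 else 0 := by
      rw [sum_ite_mem, inter_eq_right.2 (sdiff_subset.trans hSn)]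
      simp
    rw [this, ← hC2.n]
    refine forN_induct (I := fun k s' => s'.natVar 18 =
      ∑ v ∈ range k, if v ∈ S \ D.B p then 1 else 0) (by simp [n2]) ?_
    intro v s' hv hf hx ih
    rw [hC2.n] at hv
    have hC' : Ctx D L s' := hC2.frame hf
    have hcur : s'.natArr 7 v = 1 ↔ v ∈ S := by
      rw [hf.na 7 rfl, x2]
      exact hS v hv
    have hie : s'.natVar 7 = p := by rw [hf.nv 7 rfl, p2]
    have hbag := hC'.bag p hpm v hv
    rw [sum_range_succ, ← ih]
    simp only [isOne, bagAt, exec_ite, BExpr.Holds, NExpr.eval, hx, hie, hcur, hbag, exec_setN,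
      exec_skip, mem_sdiff]
    split_ifs with h
    · simp
    · simp
  have hC3 : Ctx D L (A.exec s2) := hC2.exec A
  have e3 : (A.exec s2).natArr 7 = s.natArr 7 ∧ (A.exec s2).natVar 6 = c ∧
      (A.exec s2).natVar 7 = p ∧ (A.exec s2).realVar 3 = 0 ∧ (A.exec s2).tab 9 = s1.tab 9 :=
    ⟨by rw [exec_natArr A s2, x2], by rw [exec_natVar A s2, c2], by rw [exec_natVar A s2, p2],
      by rw [exec_realVar A s2, r2], by rw [exec_tab A s2, t2]⟩
  set s3 := A.exec s2
  clear_value s3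
  obtain ⟨x3, c3, p3, r3, t3⟩ := e3
  set C : FProg := .ite
    (.and (.and (.natLe (.add (.var 12) (.const 1)) (.var 11))
        (isOne (.arr 0 (.add (.arr 4 (.var 11)) (.var 12)))))
      (.and (.and (isOne (bagAt 6 11)) (isOne (bagAt 6 12)))
        (.not (.and (isOne (bagAt 7 11)) (isOne (bagAt 7 12))))))
    (.ite (isOne (.arr 7 (.var 11)))
      (.ite (isOne (.arr 7 (.var 12))) (.setR 3 (.add (.var 3) (.var 0)))
        (.setR 3 (.add (.var 3) (.var 1))))
      (.ite (isOne (.arr 7 (.var 12))) (.setR 3 (.add (.var 3) (.var 1))) .skip))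
    .skip
  set loc := D.E.filter fun e =>
    (e.1 ∈ D.B c ∧ e.2 ∈ D.B c) ∧ ¬ (e.1 ∈ D.B p ∧ e.2 ∈ D.B p) with hloc
  have hval : (exec (.forN 11 0 (.forN 12 0 C)) s3).realVar 3 =
      ∑ e ∈ loc, pairWeight D.a₁ D.a₂ S e := by
    have : ∑ e ∈ loc, pairWeight D.a₁ D.a₂ S e = ∑ u ∈ range D.n, ∑ v ∈ range D.n,
        if (u, v) ∈ loc then pairWeight D.a₁ D.a₂ S (u, v) else 0 := by
      rw [← sum_product' (f := fun u v =>
        if (u, v) ∈ loc then pairWeight D.a₁ D.a₂ S (u, v) else 0)]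
      simp only [Prod.mk.eta]
      rw [sum_ite_mem, inter_eq_right.2]
      intro e he
      have := hD.edge e (mem_filter.1 he).1
      exact mem_product.2 ⟨mem_range.2 this.1, mem_range.2 this.2⟩
    rw [this, ← hC3.n]
    refine forN_induct (I := fun k s' => s'.realVar 3 =
      ∑ u ∈ range k, ∑ v ∈ range (s3.natVar 0),
        if (u, v) ∈ loc then pairWeight D.a₁ D.a₂ S (u, v) else 0) (by simp [r3]) ?_
    intro u s4 hu hf4 hx4 ih4
    rw [hC3.n] at hu
    have hC4 : Ctx D L s4 := hC3.frame hf4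
    rw [sum_range_succ, ← ih4, ← hf4.nv 0 rfl]
    simp only [Mem.setNat_realVar]
    refine forN_induct (I := fun k s' => s'.realVar 3 = s4.realVar 3 +
      ∑ v ∈ range k, if (u, v) ∈ loc then pairWeight D.a₁ D.a₂ S (u, v) else 0) (by simp) ?_
    intro v s5 hv hf5 hx5 ih5
    rw [hC4.n] at hv
    have hC5 : Ctx D L s5 := hC4.frame hf5
    have hcur : ∀ w < D.n, s5.natArr 7 w = 1 ↔ w ∈ S := fun w hw => by
      rw [hf5.na 7 rfl, hf4.na 7 rfl, x3]
      exact hS w hw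
    have h11 : s5.natVar 11 = u := by rw [hf5.nv 11 rfl, hx4]
    have h6 : s5.natVar 6 = c := by rw [hf5.nv 6 rfl, hf4.nv 6 rfl, c3]
    have h7 : s5.natVar 7 = p := by rw [hf5.nv 7 rfl, hf4.nv 7 rfl, p3]
    rw [sum_range_succ, ← add_assoc, ← ih5]
    simp only [C, isOne, bagAt, exec_ite, BExpr.Holds, NExpr.eval, RExpr.eval, hx5, h11, h6, h7,
      hcur u hu, hcur v hv, hC5.bag c hcm u hu, hC5.bag c hcm v hv, hC5.bag p hpm u hu,
      hC5.bag p hpm v hv, Nat.succ_le_iff, hC5.adj u hu v hv, exec_setR, exec_skip, hloc,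
      mem_filter, pairWeight, hC5.a₁, hC5.a₂]
    split_ifs <;> simp
  set s4 := exec (.forN 11 0 (.forN 12 0 C)) s3 with hs4
  have h18 : s4.natVar 18 = (S \ D.B p).card := by
    rw [hs4, exec_natVar (.forN 11 0 (.forN 12 0 C)) s3, hcard]
  have t4 : s4.tab 9 = s1.tab 9 := by rw [hs4, exec_tab (.forN 11 0 (.forN 12 0 C)) s3, t3]
  clear_value s4
  rw [coeff_monomial]
  simp only [exec_stN, exec_stR, NExpr.eval, RExpr.eval, h18, Mem.tab, Mem.storeReal_natArr,
    Mem.storeReal_realArr, Mem.storeNat_natArr, Mem.storeNat_realVar, Mem.storeNat_realArr,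
    Mem.storeNat_natVar, true_and]
  by_cases hjc : j = (S \ D.B p).card
  · simp [hjc, hval]
  · have := ht1 j hj
    rw [← t4, Mem.tab] at this
    simp only [hjc, if_false, Ne.symm hjc]
    exact this

end LocalPartition

/-! ### Polynomial arithmetic on table rows -/

namespace LocalPartition

open Finset Polynomial FProg

open scoped Classical

theorem eval_addrAt {D : Decomp} {L : ℕ} {s : Mem} (hC : Ctx D L s) {x j : ℕ}
    (hx : s.natVar x = j) (hj : j < D.n + 1) :
    (addrAt x).eval s = s.natVar 16 + 2 ^ (D.n + (D.m + 1) + j) := by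
  simp only [addrAt, NExpr.eval, hC.n, hC.m, hx]
  rw [hC.pow _ (by omega)]

/-- Multiply one coefficient of table `9` with one of the table row of variable `16`, adding the
result to table `10`. -/
def mulBody : FProg :=
  .ite (.and (isPos (.arr 9 (.var 14))) (isPos (.arr 8 (addrAt 15))))
    (.seq (.setN 17 (.add (.var 14) (.var 15)))
      (.seq (.setR 4 (.add (.arr 9 (.var 14)) (.arr 8 (addrAt 15)))) (relax 10))) .skip

theorem mulBody_tab (s : Mem) (i : ℕ) : (mulBody.exec s).tab 10 i = s.tab 10 i +
    if i = s.natVar 14 + s.natVar 15 then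
      s.tab 9 (s.natVar 14) * s.tab 8 ((addrAt 15).eval s) else 0 := by
  have haddr : ∀ v, (addrAt 15).eval (s.setNat 17 v) = (addrAt 15).eval s := fun v => rfl
  by_cases h : s.natArr 9 (s.natVar 14) = 0
  · simp [mulBody, isPos, BExpr.Holds, NExpr.eval, h, Mem.tab]
  by_cases h' : s.natArr 8 ((addrAt 15).eval s) = 0
  · simp [mulBody, isPos, BExpr.Holds, NExpr.eval, h', Mem.tab]
  have hh : (BExpr.and (isPos (.arr 9 (.var 14))) (isPos (.arr 8 (addrAt 15)))).Holds s := ⟨h, h'⟩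
  rw [mulBody, exec_ite_pos hh]
  simp only [exec_seq, exec_setN, exec_setR, relax_tab, NExpr.eval, RExpr.eval, haddr]
  simp [Mem.tab, h, h', mp_add]

/-- Multiply the polynomial in table `9` by the row of variable `16`. -/
def mulRow : FProg :=
  .seq (clear 10) (.seq (.forN 14 3 (.forN 15 3 mulBody))
    (.forN 9 3 (.seq (.stN 9 (.var 9) (.arr 10 (.var 9))) (.stR 9 (.var 9) (.arr 10 (.var 9))))))

/-- The product is truncated at degree `n`. Table `10` is cleared only up to there; products of
higher degree are also written, over possibly stale entries, but they are never copied back. -/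
theorem mulRow_spec {D : Decomp} {L : ℕ} {s : Mem} (hC : Ctx D L s) {j : ℕ} (hj : j < D.n + 1) :
    (mulRow.exec s).tab 9 j = ∑ a ∈ range (D.n + 1), ∑ b ∈ range (D.n + 1), if j = a + b then
      s.tab 9 a * s.tab 8 (s.natVar 16 + 2 ^ (D.n + (D.m + 1) + b)) else 0 := by
  simp only [mulRow, exec_seq]
  set s1 := (clear 10).exec s with hs1
  have hC1 : Ctx D L s1 := hC.exec _
  have h10 : ∀ j < D.n + 1, s1.tab 10 j = 0 := fun j hj => clear_tab 10 s (by rwa [hC.n1])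
  have h9 : s1.tab 9 = s.tab 9 := exec_tab _ s
  have h8 : s1.tab 8 = s.tab 8 := exec_tab _ s
  have h16 : s1.natVar 16 = s.natVar 16 := exec_natVar _ s
  rw [← h9, ← h8, ← h16]
  clear_value s1
  set s2 := exec (.forN 14 3 (.forN 15 3 mulBody)) s1 with hs2
  have hC2 : Ctx D L s2 := hC1.exec _
  have hmul : ∀ j < D.n + 1, s2.tab 10 j = ∑ a ∈ range (D.n + 1), ∑ b ∈ range (D.n + 1),
      if j = a + b then
        s1.tab 9 a * s1.tab 8 (s1.natVar 16 + 2 ^ (D.n + (D.m + 1) + b)) else 0 := by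
    rw [hs2, show range (D.n + 1) = range (s1.natVar 3) by rw [hC1.n1]]
    refine forN_induct (I := fun k s' => ∀ j < D.n + 1, s'.tab 10 j =
      ∑ a ∈ range k, ∑ b ∈ range (s1.natVar 3), if j = a + b then
        s1.tab 9 a * s1.tab 8 (s1.natVar 16 + 2 ^ (D.n + (D.m + 1) + b)) else 0) ?_ ?_
    · intro j hj
      simpa using h10 j hj
    intro a s3 ha hf3 hx3 ih3 j hj
    have hC3 : Ctx D L s3 := hC1.frame hf3
    rw [hC1.n1] at ha
    rw [sum_range_succ, ← ih3 j hj, show s1.natVar 3 = s3.natVar 3 from (hf3.nv 3 rfl).symm,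
      Mem.setNat_tab]
    refine forN_induct (I := fun k s' => s'.tab 10 j = s3.tab 10 j +
      ∑ b ∈ range k, if j = a + b then
        s1.tab 9 a * s1.tab 8 (s1.natVar 16 + 2 ^ (D.n + (D.m + 1) + b)) else 0) ?_ ?_
    · simp
    intro b s4 hb hf4 hx4 ih4
    have hC4 : Ctx D L s4 := hC3.frame hf4
    rw [hC3.n1] at hb
    rw [Mem.setNat_tab, mulBody_tab, sum_range_succ, ← add_assoc, ← ih4, eval_addrAt hC4 hx4 hb,
      hf4.nv 14 rfl, hx3, hx4, hf4.tab (a := 9), hf3.tab (a := 9), hf4.tab (a := 8),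
      hf3.tab (a := 8), hf4.nv 16 rfl, hf3.nv 16 rfl]
  rw [← hmul j hj]
  clear_value s2
  rw [← hC2.n1] at hj
  refine (forN_induct (I := fun k s' => s'.tab 10 = s2.tab 10 ∧ ∀ j < k, s'.tab 9 j = s2.tab 10 j)
    ⟨rfl, by simp⟩ ?_).2 j hj
  intro i s' _ hf hx ih
  refine ⟨by rw [← ih.1]; rfl, fun j hj => ?_⟩
  rw [← ih.1]
  by_cases hji : j = i
  · simp [Mem.tab, NExpr.eval, RExpr.eval, hx, hji]
  · have := ih.2 j (by omega)
    rw [← ih.1] at this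
    rw [← this]
    simp [Mem.tab, NExpr.eval, hx, hji]

/-- Multiply the polynomial in table `9` by the tables of all children of node variable `6`. -/
def childLoop : FProg :=
  .forN 13 1 (.ite (.natEq (.arr 6 (.var 13)) (.add (.var 6) (.const 1)))
    (.seq (computeRow 13 13) mulRow) .skip)

/-- The part of table `8` that belongs to node `d` contains the polynomials `F R`. -/
def HasRows (D : Decomp) (d : ℕ) (F : Finset ℕ → MinPlus[X]) (s : Mem) : Prop :=
  ∀ R ⊆ range D.n, ∀ j < D.n + 1, s.tab 8 (addr D d R j) = (F R).coeff j

/-- Once `S` is fixed, a child `d` enters through the single row `S ∩ B d`. The loop thus performs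
at most one polynomial product per child, whatever the bag sizes, which is what keeps the base of
the exponential at 2. -/
theorem childLoop_spec {D : Decomp} (hD : D.WF) {L : ℕ} {s : Mem} (hC : Ctx D L s)
    {S : Finset ℕ} (hS : Cur D S s) {q : ℕ → ℕ} (hq : s.natArr 6 = q) {c : ℕ}
    (hc : s.natVar 6 = c) {M : ℕ → Finset ℕ → MinPlus[X]}
    (hM : ∀ d < D.m, q d = c + 1 → HasRows D d (M d) s) {F : MinPlus[X]}
    (hF : ∀ j < D.n + 1, s.tab 9 j = F.coeff j) :
    ∀ j < D.n + 1, (childLoop.exec s).tab 9 j = (F * Decomp.childProd D q M c S).coeff j := by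
  have hprod : Decomp.childProd D q M c S =
      ∏ d ∈ range D.m, if q d = c + 1 then M d (S ∩ D.B d) else 1 := by
    rw [Decomp.childProd, prod_filter]
  rw [hprod, childLoop, show range D.m = range (s.natVar 1) by rw [hC.m]]
  refine forN_induct (I := fun k s' => ∀ j < D.n + 1, s'.tab 9 j =
    (F * ∏ d ∈ range k, if q d = c + 1 then M d (S ∩ D.B d) else 1).coeff j) ?_ ?_
  · simpa using hF
  intro d s' hd hf hx ih j hj
  rw [hC.m] at hd
  have hC' : Ctx D L s' := hC.frame hf
  rw [prod_range_succ, ← mul_assoc]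
  simp only [exec_ite, BExpr.Holds, NExpr.eval, hx, hf.na 6 rfl, hf.nv 6 rfl, hq, hc]
  by_cases hqd : q d = c + 1
  · simp only [if_pos hqd, exec_seq]
    have hS' : Cur D S s' := fun v hv => by rw [hf.na 7 rfl]; exact hS v hv
    rw [coeff_mul_range _ _ hj, Mem.setNat_tab, mulRow_spec (hC'.exec (computeRow 13 13)) hj]
    refine sum_congr rfl fun a ha => sum_congr rfl fun b hb => ?_
    rw [computeRow_spec hD hC' hS' hx hx hd.le hd.le (by decide) (by decide),
      exec_tab (computeRow 13 13) s' (a := 9), exec_tab (computeRow 13 13) s' (a := 8),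
      ih a (mem_range.1 ha), hf.tab (a := 8)]
    have := hM d hd hqd (S ∩ D.B d) (inter_subset_right.trans (hD.bag d)) b (mem_range.1 hb)
    rw [addr] at this
    rw [this]
  · simp only [if_neg hqd, exec_skip, mul_one]
    exact ih j hj

/-- Add the polynomial in table `9` to the row of variable `16`. -/
def storeRow : FProg :=
  .forN 14 3 (.ite (isPos (.arr 9 (.var 14)))
    (.seq (.setN 17 (addrAt 14)) (.seq (.setR 4 (.arr 9 (.var 14))) (relax 8))) .skip)

theorem storeRow_spec {D : Decomp} {L : ℕ} {s : Mem} (hC : Ctx D L s) {c d : ℕ}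
    {R R' : Finset ℕ} (hc : c ≤ D.m) (hd : d ≤ D.m) (hR : R ⊆ range D.n) (hR' : R' ⊆ range D.n)
    (h16 : s.natVar 16 = rowAddr D c R) {j : ℕ} (hj : j < D.n + 1) :
    (storeRow.exec s).tab 8 (addr D d R' j) =
      s.tab 8 (addr D d R' j) + if d = c ∧ R' = R then s.tab 9 j else 0 := by
  -- The bound on `j` is made explicit, so that replacing it by the loop counter gives the
  -- invariant.
  suffices (storeRow.exec s).tab 8 (addr D d R' j) =
      s.tab 8 (addr D d R' j) + if d = c ∧ R' = R ∧ j < s.natVar 3 then s.tab 9 j else 0 by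
    rw [this, hC.n1]
    simp only [hj, and_true]
  refine forN_induct (I := fun k s' => s'.tab 8 (addr D d R' j) =
    s.tab 8 (addr D d R' j) + if d = c ∧ R' = R ∧ j < k then s.tab 9 j else 0) (by simp) ?_
  intro i s' hi hf hx ih
  rw [hC.n1] at hi
  have hC' : Ctx D L s' := hC.frame hf
  have haddr : (addrAt 14).eval s' = addr D c R i := by
    rw [eval_addrAt hC' hx hi, hf.nv 16 rfl, h16, addr]
  have h9 : s'.tab 9 = s.tab 9 := hf.tab
  have hstep : ((FProg.ite (isPos (.arr 9 (.var 14)))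
      (.seq (.setN 17 (addrAt 14)) (.seq (.setR 4 (.arr 9 (.var 14))) (relax 8))) .skip).exec
      s').tab 8 (addr D d R' j) = s'.tab 8 (addr D d R' j) +
      if addr D d R' j = addr D c R i then s.tab 9 i else 0 := by
    rw [← h9]
    simp only [isPos, exec_ite, BExpr.Holds, NExpr.eval, hx]
    by_cases h : s'.natArr 9 i = 0
    · simp [h, Mem.tab]
    · rw [if_pos h]
      simp only [exec_seq, exec_setN, exec_setR, relax_tab, NExpr.eval, RExpr.eval, haddr]
      simp [Mem.tab, h, hx]
  rw [Mem.setNat_tab, hstep, ih]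
  -- Distinct entries have distinct addresses, so a write affects no other row.
  have hiff : addr D d R' j = addr D c R i ↔ d = c ∧ R' = R ∧ j = i :=
    ⟨fun h => addr_injective hd hc hR' hR h, by rintro ⟨rfl, rfl, rfl⟩; rfl⟩
  simp only [hiff]
  by_cases h : d = c ∧ R' = R
  · rcases lt_trichotomy j i with hji | hji | hji
    · simp [h, hji, hji.ne, Nat.lt_succ_of_lt hji]
    · simp [h, hji]
    · simp [h, hji.not_gt, hji.ne', Nat.succ_le_iff.2 hji |>.not_gt]
  · have h1 : ∀ P : Prop, ¬ (d = c ∧ R' = R ∧ P) := fun P hP => h ⟨hP.1, hP.2.1⟩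
    simp [h1]

end LocalPartition

/-! ### Enumeration of the subsets of a bag by a binary counter -/

namespace LocalPartition

open Finset Polynomial FProg

open scoped Classical

/-- Advance the current subset of the bag of node variable `6`, read as a binary number. -/
def advance : FProg :=
  .seq (.setN 19 (.const 1))
    (.forN 12 0 (.ite (.and (isOne (.var 19)) (isOne (bagAt 6 12)))
      (.ite (isOne (.arr 7 (.var 12))) (.stN 7 (.var 12) (.const 0))
        (.seq (.stN 7 (.var 12) (.const 1)) (.setN 19 (.const 0)))) .skip))

/-- The rank of a subset of `B` in the order of enumeration. -/
noncomputable def rank (n : ℕ) (B S : Finset ℕ) : ℕ :=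
  ∑ v ∈ range n, if v ∈ S then 2 ^ (B ∩ range v).card else 0

theorem card_inter_range_succ (B : Finset ℕ) (v : ℕ) :
    (B ∩ range (v + 1)).card = (B ∩ range v).card + if v ∈ B then 1 else 0 := by
  rw [range_add_one]
  split_ifs with h
  · rw [inter_insert_of_mem h, card_insert_of_notMem (by simp)]
  · rw [inter_insert_of_notMem h, add_zero]

/-- The vertices of the bag, in increasing order, are the digits of a binary counter. The witness
`i` is the carry out of the last digit; it is nonzero only when the counter wraps around to the
empty set. -/
theorem advance_spec {D : Decomp} (hD : D.WF) {L : ℕ} {s : Mem} (hC : Ctx D L s) {S : Finset ℕ}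
    (hS : Cur D S s) {c : ℕ} (hc : s.natVar 6 = c) (hcm : c ≤ D.m) (hSB : S ⊆ D.B c) :
    ∃ S' ⊆ D.B c, Cur D S' (advance.exec s) ∧ ∃ i,
      rank D.n (D.B c) S' + i * 2 ^ (D.B c).card = rank D.n (D.B c) S + 1 := by
  rw [advance, exec_seq]
  set s1 := exec (.setN 19 (.const 1)) s with hs1
  have hC1 : Ctx D L s1 := hC.exec _
  -- Invariant: variable `19` is the carry, the digits from `k` on are still the old ones, and the
  -- low part of the new number plus the carry at its place value equals the low part of the old
  -- number plus 1.
  have key := forN_induct (x := 12) (y := 0) (s := s1)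
    (P := .ite (.and (isOne (.var 19)) (isOne (bagAt 6 12)))
      (.ite (isOne (.arr 7 (.var 12))) (.stN 7 (.var 12) (.const 0))
        (.seq (.stN 7 (.var 12) (.const 1)) (.setN 19 (.const 0)))) .skip)
    (I := fun k s' => s'.natVar 19 ≤ 1 ∧ (∀ v < D.n, s'.natArr 7 v = 1 → v ∈ D.B c) ∧
      (∀ v, k ≤ v → s'.natArr 7 v = s.natArr 7 v) ∧
      (∑ v ∈ range k, if s'.natArr 7 v = 1 then 2 ^ (D.B c ∩ range v).card else 0) +
        s'.natVar 19 * 2 ^ (D.B c ∩ range k).card =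
      (∑ v ∈ range k, if s.natArr 7 v = 1 then 2 ^ (D.B c ∩ range v).card else 0) + 1)
    ⟨by simp [hs1, NExpr.eval], fun v hv h => hSB ((hS v hv).1 h), fun _ _ => rfl, by simp [hs1, NExpr.eval]⟩ ?_
  · rw [hC1.n, inter_eq_left.2 (hD.bag c)] at key
    set s' := exec _ s1
    refine ⟨{v ∈ range D.n | s'.natArr 7 v = 1}, ?_, ?_, s'.natVar 19, ?_⟩
    · intro v hv
      simp only [mem_filter, mem_range] at hv
      exact key.2.1 v hv.1 hv.2
    · intro v hv
      simp [hv]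
    · have h1 : rank D.n (D.B c) {v ∈ range D.n | s'.natArr 7 v = 1} =
          ∑ v ∈ range D.n, if s'.natArr 7 v = 1 then 2 ^ (D.B c ∩ range v).card else 0 :=
        sum_congr rfl fun v hv => by simp [mem_range.1 hv]
      have h2 : rank D.n (D.B c) S =
          ∑ v ∈ range D.n, if s.natArr 7 v = 1 then 2 ^ (D.B c ∩ range v).card else 0 :=
        sum_congr rfl fun v hv => by simp [hS v (mem_range.1 hv)]
      rw [h1, h2, key.2.2.2]
  · intro v s' hv hf hx ⟨ih0, ih1, ih2, ih3⟩
    rw [hC1.n] at hv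
    have hC' : Ctx D L s' := hC1.frame hf
    have h6 : s'.natVar 6 = c := by rw [hf.nv 6 rfl, ← hc]; rfl
    have hbag : (isOne (bagAt 6 12)).Holds s' ↔ v ∈ D.B c := by
      simp only [isOne, bagAt, BExpr.Holds, NExpr.eval, hx, h6]
      exact hC'.bag c hcm v hv
    have hne : ∀ x, ∑ w ∈ range v, (if (s'.storeNat 7 v x).natArr 7 w = 1 then
        2 ^ (D.B c ∩ range w).card else 0) =
        ∑ w ∈ range v, (if s'.natArr 7 w = 1 then 2 ^ (D.B c ∩ range w).card else 0) :=
      fun x => sum_congr rfl fun w hw => by simp [(mem_range.1 hw).ne]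
    have hv2 := ih2 v le_rfl
    simp only [sum_range_succ, card_inter_range_succ]
    by_cases h19 : s'.natVar 19 = 1
    · by_cases hvB : v ∈ D.B c
      · rw [exec_ite_pos (b := .and (isOne (.var 19)) (isOne (bagAt 6 12))) ⟨h19, hbag.2 hvB⟩]
        by_cases hv1 : s'.natArr 7 v = 1
        · rw [exec_ite_pos (show (isOne (.arr 7 (.var 12))).Holds s' by
            simpa [isOne, BExpr.Holds, NExpr.eval, hx] using hv1)]
          simp only [exec_stN, NExpr.eval, hx, Mem.setNat_natArr, Mem.setNat_natVar, hne]
          refine ⟨by simp [h19], fun w hw h => ?_, fun w hw => ?_, ?_⟩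
          · by_cases hwv : w = v
            · rwa [hwv]
            · exact ih1 w hw (by simpa [hwv] using h)
          · have : w ≠ v := by omega
            simpa [this] using ih2 w (by omega)
          · rw [h19] at ih3
            simp only [Mem.storeNat_natArr, Mem.storeNat_natVar, h19, hvB, if_true, ← hv2, hv1,
              and_self, pow_succ]
            simp
            omega
        · rw [exec_ite_neg (show ¬ (isOne (.arr 7 (.var 12))).Holds s' by
            simpa [isOne, BExpr.Holds, NExpr.eval, hx] using hv1)]
          simp only [exec_seq, exec_setN, exec_stN, NExpr.eval, hx, Mem.setNat_natArr,
            Mem.setNat_natVar, hne]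
          refine ⟨by simp, fun w hw h => ?_, fun w hw => ?_, ?_⟩
          · by_cases hwv : w = v
            · rwa [hwv]
            · exact ih1 w hw (by simpa [hwv] using h)
          · have : w ≠ v := by omega
            simpa [this] using ih2 w (by omega)
          · rw [h19] at ih3
            simp only [Mem.storeNat_natArr, ← hv2, hv1]
            simp
            omega
      · rw [exec_ite_neg (b := .and (isOne (.var 19)) (isOne (bagAt 6 12))) fun h => hvB (hbag.1 h.2)]
        simp only [exec_skip, Mem.setNat_natArr, Mem.setNat_natVar, hvB, if_false, add_zero, hv2]
        refine ⟨by simpa using ih0, ih1, fun w hw => ih2 w (by omega), ?_⟩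
        rw [if_neg (show ¬ (19 : ℕ) = 12 by decide), add_right_comm, add_right_comm _ _ 1]
        exact congrArg (· + _) ih3
    · rw [exec_ite_neg (b := .and (isOne (.var 19)) (isOne (bagAt 6 12))) fun h => h19 h.1]
      have h0 : s'.natVar 19 = 0 := by omega
      simp only [exec_skip, Mem.setNat_natArr, Mem.setNat_natVar, hv2]
      refine ⟨by simp [h0], ih1, fun w hw => ih2 w (by omega), ?_⟩
      rw [h0, zero_mul] at ih3
      rw [if_neg (show ¬ (19 : ℕ) = 12 by decide), h0, zero_mul, add_right_comm, add_right_comm _ _ 1]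
      exact congrArg (· + _) ih3

end LocalPartition

/-! ### The table of a single node -/

namespace LocalPartition

open Finset Polynomial FProg

open scoped Classical

/-- Enter the entries for the current subset into the table of node variable `6`, whose parent is
node variable `7`, and advance the current subset. -/
def subsetStep : FProg :=
  .seq localPoly (.seq childLoop (.seq (computeRow 6 7) (.seq storeRow advance)))

/-- Compute the table of node variable `6`, whose parent is node variable `7`. -/
def process : FProg :=
  .seq (.forN 12 0 (.stN 7 (.var 12) (.const 0))) (.forN 10 4 subsetStep)

/-- Since minima are idempotent, treating a subset a second time does no harm. All bags can
therefore share one loop limit, although most may have fewer subsets. -/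
theorem sum_insert_idem {ι : Type*} [DecidableEq ι] (𝒮 : Finset ι) (P : ι → Prop)
    [DecidablePred P] (f : ι → MinPlus) (S : ι) :
    ∑ T ∈ insert S 𝒮 with P T, f T = ∑ T ∈ 𝒮 with P T, f T + if P S then f S else 0 := by
  by_cases hP : P S
  · rw [filter_insert, if_pos hP, if_pos hP]
    by_cases hS : S ∈ 𝒮
    · have hmem : S ∈ 𝒮.filter P := mem_filter.2 ⟨hS, hP⟩
      rw [insert_eq_of_mem hmem, ← add_sum_erase _ _ hmem, add_right_comm, Tropical.add_self]
    · rw [sum_insert (by simp [hS]), add_comm]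
  · rw [filter_insert, if_neg hP, if_neg hP, add_zero]

/-- With `L` at least the number of subsets of the bag, the counter passes through all of them, and
each contributes its summand of the message to the row of its trace on the parent's bag. The
condition on `q c` says that `c` is not its own child: the rows read are not among those being
written. -/
theorem process_spec {D : Decomp} (hD : D.WF) {L : ℕ} {s : Mem} (hC : Ctx D L s) {q : ℕ → ℕ}
    (hq : s.natArr 6 = q) {c p : ℕ} (hc : s.natVar 6 = c) (hp : s.natVar 7 = p) (hcm : c ≤ D.m)
    (hpm : p ≤ D.m) (hqc : q c ≠ c + 1) (hL : 2 ^ (D.B c).card ≤ L)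
    {M : ℕ → Finset ℕ → MinPlus[X]} (hM : ∀ d ≤ D.m, HasRows D d (M d) s) :
    ∀ d ≤ D.m, HasRows D d (Function.update M c (fun R => M c R + D.newTable q M c p R) d)
      (process.exec s) := by
  rw [process, exec_seq]
  set s0 := exec (.forN 12 0 (.stN 7 (.var 12) (.const 0))) s with hs0
  have hC0 : Ctx D L s0 := hC.exec _
  have hcur0 : Cur D ∅ s0 := by
    intro v hv
    have : s0.natArr 7 v = 0 := by
      rw [← hC.n] at hv
      refine forN_induct (I := fun k s' => ∀ v < k, s'.natArr 7 v = 0) (by simp) ?_ v hv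
      intro i s' _ _ hx ih v hv
      by_cases hvi : v = i
      · simp [NExpr.eval, hx, hvi]
      · simpa [NExpr.eval, hx, hvi] using ih v (by omega)
    simp [this]
  have e0 : s0.natArr 6 = q ∧ s0.natVar 6 = c ∧ s0.natVar 7 = p ∧ s0.tab 8 = s.tab 8 := by
    rw [← hq, ← hc, ← hp]
    exact ⟨exec_natArr _ s, exec_natVar _ s, exec_natVar _ s, exec_tab _ s⟩
  clear_value s0
  obtain ⟨q0, c0, p0, t0⟩ := e0
  set N := 2 ^ (D.B c).card with hN
  set G : Finset ℕ → MinPlus[X] := fun S => monomial (S \ D.B p).card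
    (mp (∑ e ∈ D.E with (e.1 ∈ D.B c ∧ e.2 ∈ D.B c) ∧ ¬ (e.1 ∈ D.B p ∧ e.2 ∈ D.B p),
      pairWeight D.a₁ D.a₂ S e)) * Decomp.childProd D q M c S with hG
  -- `𝒮` collects the subsets treated so far and `S` is the current one. Before the counter wraps,
  -- the rank of `S` is the number of rounds done and exceeds all ranks in `𝒮`, so each round adds a
  -- new subset; later only the cardinality of `𝒮` matters.
  have key := forN_induct (x := 10) (y := 4) (s := s0) (P := subsetStep)
    (I := fun t s' => ∃ (𝒮 : Finset (Finset ℕ)) (S : Finset ℕ), S ⊆ D.B c ∧ Cur D S s' ∧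
      𝒮 ⊆ (D.B c).powerset ∧ 𝒮.card = min t (N) ∧
      (t < N → rank D.n (D.B c) S = t ∧ ∀ S' ∈ 𝒮, rank D.n (D.B c) S' < t) ∧
      ∀ d ≤ D.m, ∀ R ⊆ range D.n, ∀ j < D.n + 1, s'.tab 8 (addr D d R j) =
        (M d R).coeff j + if d = c then ∑ S' ∈ 𝒮 with S' ∩ D.B p = R, (G S').coeff j else 0)
    ⟨∅, ∅, empty_subset _, hcur0, empty_subset _, by simp, by simp [rank], ?_⟩ ?_
  · obtain ⟨𝒮, -, -, -, hsub, hcard, -, htab⟩ := key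
    rw [hC0.lim, min_eq_right hL] at hcard
    have h𝒮 : 𝒮 = (D.B c).powerset :=
      eq_of_subset_of_card_le hsub (by rw [card_powerset, hcard])
    intro d hd R hR j hj
    rw [htab d hd R hR j hj, h𝒮]
    by_cases hdc : d = c
    · subst hdc
      rw [Function.update_self, if_pos rfl, coeff_add, Decomp.newTable, message, finsetSum_coeff]
    · rw [Function.update_of_ne hdc, if_neg hdc, add_zero]
  · intro d hd R hR j hj
    simp only [Mem.setNat_tab, t0]
    rw [hM d hd R hR j hj]
    simp
  · rintro t s1 - hf - ⟨𝒮, S, hSB, hcur, hsub, hcard, hrank, htab⟩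
    have hC1 : Ctx D L s1 := hC0.frame hf
    have hSn : S ⊆ range D.n := hSB.trans (hD.bag c)
    have q1 : s1.natArr 6 = q := by rw [hf.na 6 rfl, q0]
    have c1 : s1.natVar 6 = c := by rw [hf.nv 6 rfl, c0]
    have p1 : s1.natVar 7 = p := by rw [hf.nv 7 rfl, p0]
    simp only [subsetStep, exec_seq]
    have h9 := fun j hj => localPoly_spec hD hC1 hSn hcur c1 p1 hcm hpm (j := j) hj
    set s2 := localPoly.exec s1
    have hC2 : Ctx D L s2 := hC1.exec localPoly
    have hcur2 : Cur D S s2 := fun v hv => by rw [exec_natArr localPoly s1]; exact hcur v hv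
    have q2 : s2.natArr 6 = q := by rw [exec_natArr localPoly s1, q1]
    have c2 : s2.natVar 6 = c := by rw [exec_natVar localPoly s1, c1]
    have p2 : s2.natVar 7 = p := by rw [exec_natVar localPoly s1, p1]
    have t2 : s2.tab 8 = s1.tab 8 := exec_tab localPoly s1
    have hrows : ∀ d < D.m, q d = c + 1 → HasRows D d (M d) s2 := by
      intro d hd hqd R hR j hj
      have hdc : d ≠ c := by
        rintro rfl
        exact hqc hqd
      rw [t2, htab d hd.le R hR j hj, if_neg hdc, add_zero]
    have h9' := childLoop_spec hD hC2 hcur2 q2 c2 hrows h9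
    clear_value s2
    set s3 := childLoop.exec s2
    have hC3 : Ctx D L s3 := hC2.exec childLoop
    have hcur3 : Cur D S s3 := fun v hv => by rw [exec_natArr childLoop s2]; exact hcur2 v hv
    have c3 : s3.natVar 6 = c := by rw [exec_natVar childLoop s2, c2]
    have p3 : s3.natVar 7 = p := by rw [exec_natVar childLoop s2, p2]
    have t3 : s3.tab 8 = s2.tab 8 := exec_tab childLoop s2
    have h16 := computeRow_spec hD hC3 hcur3 c3 p3 hcm hpm (by decide) (by decide)
    clear_value s3
    set s4 := (computeRow 6 7).exec s3
    have hC4 : Ctx D L s4 := hC3.exec (computeRow 6 7)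
    have hcur4 : Cur D S s4 := fun v hv => by
      rw [exec_natArr (computeRow 6 7) s3]; exact hcur3 v hv
    have c4 : s4.natVar 6 = c := by rw [exec_natVar (computeRow 6 7) s3, c3]
    have t4 : s4.tab 8 = s3.tab 8 := exec_tab (computeRow 6 7) s3
    have t4' : s4.tab 9 = s3.tab 9 := exec_tab (computeRow 6 7) s3
    have hRn : S ∩ D.B p ⊆ range D.n := inter_subset_left.trans hSn
    have hstore := fun {d R j} hd hR' hj => storeRow_spec (d := d) (R' := R) (j := j) hC4 hcm hd
      hRn hR' h16 hj
    clear_value s4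
    set s5 := storeRow.exec s4
    have hC5 : Ctx D L s5 := hC4.exec storeRow
    have hcur5 : Cur D S s5 := fun v hv => by rw [exec_natArr storeRow s4]; exact hcur4 v hv
    have c5 : s5.natVar 6 = c := by rw [exec_natVar storeRow s4, c4]
    clear_value s5
    obtain ⟨S', hS'B, hcur', i, hi⟩ := advance_spec hD hC5 hcur5 c5 hcm hSB
    have t6 : (advance.exec s5).tab 8 = s5.tab 8 := exec_tab advance s5
    set s6 := advance.exec s5
    clear_value s6
    rw [← hN] at hi
    have hins : insert S 𝒮 ⊆ (D.B c).powerset := insert_subset (mem_powerset.2 hSB) hsub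
    refine ⟨insert S 𝒮, S', hS'B, hcur', hins, ?_, ?_, ?_⟩
    · by_cases ht : t < N
      · rw [card_insert_of_notMem, hcard]
        · omega
        · intro hmem
          have := (hrank ht).2 S hmem
          have := (hrank ht).1
          omega
      · have h1 := card_le_card hins
        have h2 := card_le_card (subset_insert S 𝒮)
        rw [card_powerset, ← hN] at h1
        omega
    · intro ht
      have hr := hrank (by omega)
      -- No wrap-around yet: a carry would need rank `N - 1`, but `t + 1 < N`.
      have hi0 : i = 0 := by
        by_contra hne
        have : 1 * N ≤ i * N := Nat.mul_le_mul (by omega) le_rfl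
        omega
      rw [hi0, zero_mul, add_zero] at hi
      refine ⟨by omega, fun T hT => ?_⟩
      rcases mem_insert.1 hT with rfl | hT
      · omega
      · have := hr.2 T hT
        omega
    · intro d hd R hR j hj
      rw [Mem.setNat_tab, t6, hstore hd hR hj, t4, t3, t2, htab d hd R hR j hj, t4', h9' j hj]
      by_cases hdc : d = c
      · simp only [hdc, if_true, true_and]
        rw [sum_insert_idem, add_assoc]
        simp only [eq_comm (a := R)]
        rfl
      · simp [hdc]

end LocalPartition

/-! ### The order of elimination and the final answer -/

namespace LocalPartition

open Finset Polynomial FProg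

open scoped Classical

/-- Count the unprocessed neighbours of node variable `6` in variable `8`, and put the last one, or
the root if there is none, into variable `7`. -/
def findParent : FProg :=
  .seq (.setN 8 (.const 0)) (.seq (.setN 7 (.var 1)) (.forN 9 1
    (.ite (.and (.natEq (.arr 6 (.var 9)) (.const 0))
        (isOne (.arr 1 (.add (.arr 5 (.var 6)) (.var 9)))))
      (.seq (.setN 8 (.add (.var 8) (.const 1))) (.setN 7 (.var 9))) .skip)))

theorem findParent_spec {D : Decomp} {L : ℕ} {s : Mem} (hC : Ctx D L s) {q : ℕ → ℕ}
    (hq : s.natArr 6 = q) {c : ℕ} (hc : s.natVar 6 = c) (hcm : c < D.m) :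
    (findParent.exec s).natVar 8 = {i ∈ range D.m | q i = 0 ∧ D.T c i}.card ∧
    ({i ∈ range D.m | q i = 0 ∧ D.T c i} = ∅ ∧ (findParent.exec s).natVar 7 = D.m ∨
      (findParent.exec s).natVar 7 ∈ {i ∈ range D.m | q i = 0 ∧ D.T c i}) := by
  simp only [findParent, exec_seq]
  set s1 := exec (.setN 7 (.var 1)) (exec (.setN 8 (.const 0)) s) with hs1
  have hC1 : Ctx D L s1 := (hC.exec (.setN 8 (.const 0))).exec _
  have e1 : s1.natArr 6 = q ∧ s1.natVar 6 = c ∧ s1.natVar 8 = 0 ∧ s1.natVar 7 = D.m := by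
    rw [← hq, ← hc, ← hC.m]
    exact ⟨rfl, rfl, rfl, rfl⟩
  clear_value s1
  obtain ⟨q1, c1, n1, p1⟩ := e1
  rw [show range D.m = range (s1.natVar 1) by rw [hC1.m]]
  refine forN_induct (I := fun k s' =>
    s'.natVar 8 = {i ∈ range k | q i = 0 ∧ D.T c i}.card ∧
    ({i ∈ range k | q i = 0 ∧ D.T c i} = ∅ ∧ s'.natVar 7 = D.m ∨
      s'.natVar 7 ∈ {i ∈ range k | q i = 0 ∧ D.T c i})) (by simp [n1, p1]) ?_
  intro i s' hi hf hx ih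
  rw [hC1.m] at hi
  have hC' : Ctx D L s' := hC1.frame hf
  have hb : (BExpr.and (.natEq (.arr 6 (.var 9)) (.const 0))
      (isOne (.arr 1 (.add (.arr 5 (.var 6)) (.var 9))))).Holds s' ↔ q i = 0 ∧ D.T c i := by
    rw [← hC'.tree c hcm i hi]
    simp only [isOne, BExpr.Holds, NExpr.eval, hx, hf.na 6 rfl, q1, hf.nv 6 rfl, c1]
  rw [range_add_one, filter_insert]
  by_cases h : q i = 0 ∧ D.T c i
  · rw [exec_ite_pos (hb.2 h), if_pos h, card_insert_of_notMem (by simp), ← ih.1]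
    simp [NExpr.eval, hx, h]
  · rw [exec_ite_neg (fun h' => h (hb.1 h')), if_neg h]
    simpa using ih

/-- Process node variable `6` if it is a leaf of the unprocessed part of the tree. -/
def nodeStep : FProg :=
  .ite (.natEq (.arr 6 (.var 6)) (.const 0))
    (.seq findParent (.ite (.natLe (.var 8) (.const 1))
      (.seq process (.stN 6 (.var 6) (.add (.var 7) (.const 1)))) .skip)) .skip

/-- The memory represents an intermediate stage of the recursion. -/
structure Stage (D : Decomp) (L : ℕ) (s : Mem) : Prop where
  ctx : Ctx D L s
  inv : ∃ M, D.Inv (s.natArr 6) M ∧ ∀ d ≤ D.m, HasRows D d (M d) s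

theorem Stage.of_eq {D : Decomp} {L : ℕ} {s s' : Mem} (h : Stage D L s) (hC : Ctx D L s')
    (hq : s'.natArr 6 = s.natArr 6) (ht : s'.tab 8 = s.tab 8) : Stage D L s' := by
  obtain ⟨M, h1, h2⟩ := h.inv
  refine ⟨hC, M, by rwa [hq], fun d hd R hR j hj => ?_⟩
  rw [ht]
  exact h2 d hd R hR j hj

/-- Either `c` is an unprocessed leaf and gets processed by `Decomp.Inv.step`, or nothing changes in
the recursion. In the second case an unprocessed `c` is known to have two unprocessed neighbours,
which is recorded for the progress argument in `round_spec`. -/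
theorem nodeStep_spec {D : Decomp} (hD : D.WF) {L : ℕ} {s : Mem} (hs : Stage D L s) {c : ℕ}
    (hc : s.natVar 6 = c) (hcm : c < D.m) (hL : 2 ^ (D.B c).card ≤ L) :
    Stage D L (nodeStep.exec s) ∧
    (D.alive ((nodeStep.exec s).natArr 6) = D.alive (s.natArr 6) ∧
        (c ∈ D.alive (s.natArr 6) → 2 ≤ {i ∈ range D.m | s.natArr 6 i = 0 ∧ D.T c i}.card) ∨
      c ∈ D.alive (s.natArr 6) ∧
        D.alive ((nodeStep.exec s).natArr 6) = (D.alive (s.natArr 6)).erase c) := by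
  set q := s.natArr 6 with hq
  have hmem : c ∈ D.alive q ↔ q c = 0 := by simp [Decomp.mem_alive, hcm.le]
  have hb : (BExpr.natEq (.arr 6 (.var 6)) (.const 0)).Holds s ↔ q c = 0 := by
    simp [BExpr.Holds, NExpr.eval, hc, hq]
  by_cases hqc : q c = 0
  · rw [nodeStep, exec_ite_pos (hb.2 hqc), exec_seq]
    have hp := findParent_spec hs.ctx hq.symm hc hcm
    have hC1 : Ctx D L (findParent.exec s) := hs.ctx.exec _
    have q1 : (findParent.exec s).natArr 6 = q := exec_natArr _ s
    have c1 : (findParent.exec s).natVar 6 = c := by rw [exec_natVar findParent s, hc]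
    have t1 : (findParent.exec s).tab 8 = s.tab 8 := exec_tab _ s
    set s1 := findParent.exec s
    clear_value s1
    by_cases hdeg : s1.natVar 8 ≤ 1
    · rw [exec_ite_pos (show (BExpr.natLe (.var 8) (.const 1)).Holds s1 from hdeg), exec_seq]
      obtain ⟨M, hI, hM⟩ := hs.inv
      rw [← hq] at hI
      obtain ⟨p, hp7⟩ : ∃ p, s1.natVar 7 = p := ⟨_, rfl⟩
      rw [hp7] at hp
      have hpm : p ≤ D.m := by
        rcases hp.2 with h | h
        · exact h.2.le
        · exact (mem_range.1 (mem_filter.1 h).1).le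
      have hpA : p ∈ D.alive q := by
        rcases hp.2 with h | h
        · rw [h.2]
          exact Decomp.mem_alive.2 ⟨le_rfl, hI.root⟩
        · exact Decomp.mem_alive.2 ⟨hpm, (mem_filter.1 h).2.1⟩
      have hpc : p ≠ c := by
        rintro rfl
        rcases hp.2 with h | h
        · omega
        · exact hD.irrefl _ (mem_filter.1 h).2.2
      have huniq : ∀ i ∈ D.alive q, D.T c i → i = p := by
        intro i hi hci
        have him : i ∈ {i ∈ range D.m | q i = 0 ∧ D.T c i} :=
          mem_filter.2 ⟨mem_range.2 (hD.lt c i hci), (Decomp.mem_alive.1 hi).2, hci⟩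
        rcases hp.2 with h | h
        · rw [h.1] at him
          simp at him
        · rw [hp.1] at hdeg
          exact card_le_one.1 hdeg i him p h
      have hrows : ∀ d ≤ D.m, HasRows D d (M d) s1 := fun d hd R hR j hj => by
        rw [t1]
        exact hM d hd R hR j hj
      have hproc := process_spec hD hC1 q1 c1 hp7 hcm.le hpm (by omega) hL hrows
      have hC2 : Ctx D L (process.exec s1) := hC1.exec _
      have q2 : (process.exec s1).natArr 6 = q := by rw [exec_natArr process s1, q1]
      have c2 : (process.exec s1).natVar 6 = c := by rw [exec_natVar process s1, c1]
      have p2 : (process.exec s1).natVar 7 = p := by rw [exec_natVar process s1, hp7]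
      set s2 := process.exec s1
      clear_value s2
      have q3 : (exec (.stN 6 (.var 6) (.add (.var 7) (.const 1))) s2).natArr 6 =
          Function.update q c (p + 1) := by
        ext i
        simp [NExpr.eval, c2, p2, q2, Function.update_apply]
      refine ⟨⟨hC2.exec _, _, ?_, hproc⟩, Or.inr ⟨hmem.2 hqc, ?_⟩⟩
      · rw [q3]
        exact hI.step hD.symm hD.irrefl hD.bag hD.edge hcm (hmem.2 hqc) hpA hpc huniq
      · rw [q3, Decomp.alive_update]
    · rw [exec_ite_neg (show ¬ (BExpr.natLe (.var 8) (.const 1)).Holds s1 from hdeg), exec_skip]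
      refine ⟨hs.of_eq hC1 q1 t1, Or.inl ⟨by rw [q1], fun _ => ?_⟩⟩
      rw [← hp.1]
      omega
  · rw [nodeStep, exec_ite_neg (fun h => hqc (hb.1 h)), exec_skip]
    exact ⟨hs, Or.inl ⟨rfl, fun h => absurd (hmem.1 h) hqc⟩⟩

/-- Try all nodes once. -/
def round : FProg := .forN 6 1 nodeStep

/-- A round need not follow any particular order: it makes progress because every nonempty set of
tree nodes contains one with at most one neighbour in the set. The artificial root is never removed
and is left out of the count. -/
theorem round_spec {D : Decomp} (hD : D.WF) {L : ℕ} {s : Mem} (hs : Stage D L s)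
    (hL : ∀ c < D.m, 2 ^ (D.B c).card ≤ L) :
    Stage D L (round.exec s) ∧ ((D.alive ((round.exec s).natArr 6)).erase D.m).card ≤
      ((D.alive (s.natArr 6)).erase D.m).card - 1 := by
  set A := D.alive (s.natArr 6) with hA
  have hAq : ∀ {q : ℕ → ℕ}, D.alive q = A → ∀ c, {i ∈ range D.m | q i = 0 ∧ D.T c i} =
      {i ∈ A.erase D.m | D.T c i} := by
    rintro q hq c
    ext i
    simp only [mem_filter, mem_range, ← hq, mem_erase, Decomp.mem_alive]
    have : i < D.m ↔ i ≠ D.m ∧ i ≤ D.m := by omega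
    tauto
  have key : Stage D L (round.exec s) ∧ D.alive ((round.exec s).natArr 6) ⊆ A ∧
      (D.alive ((round.exec s).natArr 6) = A → ∀ c < s.natVar 1, c ∈ A →
        2 ≤ {i ∈ A.erase D.m | D.T c i}.card) := by
    refine forN_induct (I := fun k s' => Stage D L s' ∧ D.alive (s'.natArr 6) ⊆ A ∧
      (D.alive (s'.natArr 6) = A → ∀ c < k, c ∈ A → 2 ≤ {i ∈ A.erase D.m | D.T c i}.card)) ?_ ?_
    · exact ⟨hs.of_eq (hs.ctx.exec (.setN 6 (.const 0))) rfl rfl, Subset.refl _, by simp⟩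
    · intro c s' hc hf hx ⟨h1, h2, h3⟩
      rw [hs.ctx.m] at hc
      obtain ⟨h4, h5⟩ := nodeStep_spec hD h1 hx hc (hL c hc)
      refine ⟨h4.of_eq (h4.ctx.exec (.setN 6 (.const (c + 1)))) rfl rfl, ?_, ?_⟩
      · rw [Mem.setNat_natArr]
        rcases h5 with h5 | h5
        · rwa [h5.1]
        · rw [h5.2]
          exact (erase_subset _ _).trans h2
      · rw [Mem.setNat_natArr]
        intro heq d hd hdA
        rcases h5 with h5 | h5
        · rw [h5.1] at heq
          rcases Nat.lt_succ_iff_lt_or_eq.1 hd with hdc | rfl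
          · exact h3 heq d hdc hdA
          · rw [← hAq heq]
            exact h5.2 (heq ▸ hdA)
        · exfalso
          rw [h5.2] at heq
          have : c ∈ A := h2 h5.1
          rw [← heq] at this
          simp at this
  refine ⟨key.1, ?_⟩
  by_cases heq : D.alive ((round.exec s).natArr 6) = A
  -- If the whole round removed nothing, all degrees were taken with respect to the same set `A`,
  -- and they are at least 2; this excludes a leaf.
  · have hempty : A.erase D.m = ∅ := by
      by_contra hne
      obtain ⟨c, hc, hdeg⟩ := hD.leaf (A.erase D.m) (fun i hi => by
        rw [hA, mem_erase, Decomp.mem_alive] at hi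
        exact mem_range.2 (by omega)) (nonempty_iff_ne_empty.2 hne)
      rw [mem_erase] at hc
      have hcm : c < D.m := by
        have := (Decomp.mem_alive.1 hc.2).1
        omega
      have := key.2.2 heq c (by rwa [hs.ctx.m]) hc.2
      omega
    simp [heq, hempty]
  · refine Nat.le_sub_one_of_lt (card_lt_card ?_)
    obtain ⟨M, hI, -⟩ := key.1.inv
    refine ⟨erase_subset_erase _ key.2.1, fun hsub => heq (Subset.antisymm key.2.1 fun i hi => ?_)⟩
    by_cases him : i = D.m
    · rw [him]
      exact Decomp.mem_alive.2 ⟨le_rfl, hI.root⟩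
    · exact (mem_erase.1 (hsub (mem_erase.2 ⟨him, hi⟩))).2

/-- Compute the tables of all nodes and finally of the root. -/
def mainLoop : FProg :=
  .seq (.forN 5 1 round) (.seq (.setN 6 (.var 1)) (.seq (.setN 7 (.var 1)) process))

/-- Each round lowers the number of unprocessed nodes other than the root, so `m` rounds suffice.
The root is then processed with itself as parent; as its bag is empty, this merely multiplies the
tables of its children into the row of the empty set. -/
theorem mainLoop_spec {D : Decomp} (hD : D.WF) {L : ℕ} {s : Mem} (hs : Stage D L s)
    (hL : ∀ c ≤ D.m, 2 ^ (D.B c).card ≤ L) :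
    Ctx D L (mainLoop.exec s) ∧ ∀ j < D.n + 1, (mainLoop.exec s).tab 8 (addr D D.m ∅ j) =
      (partialSum D.a₁ D.a₂ D.E (range D.n) ∅).coeff j := by
  have key : Stage D L (exec (.forN 5 1 round) s) ∧
      ((D.alive ((exec (.forN 5 1 round) s).natArr 6)).erase D.m).card ≤ D.m - s.natVar 1 := by
    refine forN_induct (I := fun k s' => Stage D L s' ∧
      ((D.alive (s'.natArr 6)).erase D.m).card ≤ D.m - k) ?_ ?_
    · refine ⟨hs.of_eq (hs.ctx.exec (.setN 5 (.const 0))) rfl rfl, ?_⟩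
      rw [Nat.sub_zero]
      refine (card_le_card fun i hi => ?_).trans (card_range D.m).le
      rw [mem_erase, Decomp.mem_alive] at hi
      exact mem_range.2 (by omega)
    · intro i s' _ _ _ ih
      obtain ⟨h1, h2⟩ := round_spec hD ih.1 fun c hc => hL c hc.le
      refine ⟨h1.of_eq (h1.ctx.exec (.setN 5 (.const (i + 1)))) rfl rfl, h2.trans ?_⟩
      omega
  simp only [mainLoop, exec_seq]
  set s1 := exec (.forN 5 1 round) s
  clear_value s1
  obtain ⟨hs1, hcard⟩ := key
  rw [hs.ctx.m, Nat.sub_self, Nat.le_zero, card_eq_zero] at hcard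
  set s2 := exec (.setN 7 (.var 1)) (exec (.setN 6 (.var 1)) s1) with hs2
  have hC2 : Ctx D L s2 := (hs1.ctx.exec (.setN 6 (.var 1))).exec _
  obtain ⟨M, hI, hM⟩ := (hs1.of_eq hC2 rfl rfl).inv
  refine ⟨hC2.exec process, fun j hj => ?_⟩
  have h6 : s2.natVar 6 = D.m := hs1.ctx.m
  have h7 : s2.natVar 7 = D.m := hs1.ctx.m
  have hproc := process_spec hD hC2 rfl h6 h7 le_rfl le_rfl (by rw [hI.root]; omega)
    (hL D.m le_rfl) hM D.m le_rfl ∅ (empty_subset _) j hj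
  rw [hproc, Function.update_self, hI.zero D.m (Decomp.mem_alive.2 ⟨le_rfl, hI.root⟩),
    hI.newTable_root hD.root]
  · simp
  · intro d hd hqd
    have : d ∈ (D.alive (s1.natArr 6)).erase D.m :=
      mem_erase.2 ⟨hd.ne, Decomp.mem_alive.2 ⟨hd.le, hqd⟩⟩
    rw [hcard] at this
    simp at this

/-- Compare the value found with real variable `2`. -/
def answer : FProg :=
  let A : NExpr := .add (.arr 3 (.add (.var 0) (.var 1)))
    (.arr 3 (.add (.add (.var 0) (.add (.var 1) (.const 1))) (.var 2)))
  .ite (.and (.natLe (.var 2) (.var 0)) (.and (isPos (.arr 8 A)) (.realLe (.arr 8 A) (.var 2))))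
    (.setN 0 (.const 1)) (.setN 0 (.const 0))

theorem answer_spec {D : Decomp} (hE : ∀ e ∈ D.E, e.1 < D.n ∧ e.2 < D.n) {L : ℕ} {s : Mem}
    (hC : Ctx D L s)
    (ht : ∀ j < D.n + 1, s.tab 8 (addr D D.m ∅ j) =
      (partialSum D.a₁ D.a₂ D.E (range D.n) ∅).coeff j) {k : ℕ} {r : ℝ} (hk : s.natVar 2 = k)
    (hr : s.realVar 2 = r) :
    AnswersCorrectly (answer.exec s) (∃ Z ⊆ range D.n, Z.card = k ∧
      ∑ e ∈ D.E, pairWeight D.a₁ D.a₂ Z e ≤ r) := by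
  set A : NExpr := .add (.arr 3 (.add (.var 0) (.var 1)))
    (.arr 3 (.add (.add (.var 0) (.add (.var 1) (.const 1))) (.var 2))) with hA
  have hb : (BExpr.and (.natLe (.var 2) (.var 0))
      (.and (isPos (.arr 8 A)) (.realLe (.arr 8 A) (.var 2)))).Holds s ↔
      ∃ Z ⊆ range D.n, Z.card = k ∧ ∑ e ∈ D.E, pairWeight D.a₁ D.a₂ Z e ≤ r := by
    simp only [BExpr.Holds, isPos, NExpr.eval, RExpr.eval, hk, hC.n, hr]
    -- For `k > n` the powers of two needed for the address are not all tabulated, so the program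
    -- tests this first; no set of that size exists.
    by_cases hkn : k ≤ D.n
    · have haddr : A.eval s = addr D D.m ∅ k := by
        simp only [hA, NExpr.eval, hC.n, hC.m, hk, addr, rowAddr, sum_empty, add_zero]
        rw [hC.pow _ (by omega), hC.pow _ (by omega)]
      rw [← untrop_coeff_partialSum_le hE, ← ht k (by omega), ← haddr]
      by_cases h0 : s.natArr 8 (A.eval s) = 0
      · simp [Mem.tab, h0]
      · simp only [Mem.tab, h0, if_false, mp, Tropical.untrop_trop, WithTop.coe_le_coe, hkn,
          not_false_eq_true, true_and]
    · refine ⟨fun h => absurd h.1 hkn, ?_⟩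
      rintro ⟨Z, hZ, rfl, -⟩
      exact absurd ((card_le_card hZ).trans (card_range _).le) hkn
  constructor
  · intro h
    rw [answer, exec_ite_pos (hb.2 h)]
    simp [NExpr.eval]
  · intro h
    rw [answer, exec_ite_neg (fun h' => h (hb.1 h'))]
    simp [NExpr.eval]

end LocalPartition

namespace LocalPartition

open Finset Polynomial FProg

open scoped Classical

/-! ### From tree decompositions to the data of the recursion -/

/-- A node of `A` farthest from some fixed `u` works: a neighbour of it in `A` is not farther away,
so it must be the last but one node on the path from `u`. -/
theorem exists_leaf {V : Type*} {T : SimpleGraph V} (hT : T.IsTree) {A : Finset V}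
    (hA : A.Nonempty) : ∃ c ∈ A, {i ∈ A | T.Adj c i}.card ≤ 1 := by
  obtain ⟨u⟩ := hT.connected.nonempty
  obtain ⟨c, hc, hmax⟩ := A.exists_max_image (T.dist u) hA
  obtain ⟨P, hP, hPl⟩ := (hT.connected u c).exists_path_of_dist
  refine ⟨c, hc, card_le_one.2 ?_⟩
  have key : ∀ i ∈ A, T.Adj c i → i = P.penultimate := by
    intro i hi hci
    obtain ⟨Q, hQ, hQl⟩ := (hT.connected u i).exists_path_of_dist
    refine hT.isAcyclic.eq_penultimate_of_adj_end hP hci ?_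
    -- If the path to `i` passed through `c`, it would be the path to `c` prolonged by one edge, and
    -- `i` would be farther than the maximum.
    by_cases hcQ : c ∈ Q.support
    · exfalso
      have := congrArg SimpleGraph.Walk.length (hT.isAcyclic.path_concat hP hQ hci hcQ)
      rw [SimpleGraph.Walk.length_concat] at this
      have := hmax i hi
      omega
    · exact hT.isAcyclic.mem_support_of_ne_mem_support_of_adj_of_isPath hP hQ hci hcQ
  intro i hi j hj
  rw [mem_filter] at hi hj
  rw [key i hi.1 hi.2, key j hj.1 hj.2]

/-- Division with remainder recovers row and column. The row index is not bounded: rows past the end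
read as 0, which is how the artificial root gets its empty bag. -/
theorem matrixArray_eq_one {r c : ℕ} (R : Fin r → Fin c → Prop) {i j : ℕ} (hj : j < c) :
    matrixArray R (i * c + j) = 1 ↔ ∃ hi : i < r, R ⟨i, hi⟩ ⟨j, hj⟩ := by
  rw [matrixArray]
  simp only [ite_eq_left_iff, zero_ne_one, imp_false, not_not]
  constructor
  · rintro ⟨a, b, hab, hR⟩
    have h1 : i = a := by
      have := congrArg (· / c) hab
      simpa [Nat.add_div_of_dvd_right, Nat.mul_add_div, mul_comm _ c, Nat.div_eq_of_lt hj,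
        Nat.div_eq_of_lt b.2, Nat.pos_of_ne_zero (fun h : c = 0 => by omega)] using this
    subst h1
    have h2 : j = b := by omega
    subst h2
    exact ⟨a.2, hR⟩
  · rintro ⟨hi, hR⟩
    exact ⟨⟨i, hi⟩, ⟨j, hj⟩, rfl, hR⟩

/-- The edges, each directed to its smaller end. -/
noncomputable def edgePairs {n : ℕ} (G : SimpleGraph (Fin n)) : Finset (ℕ × ℕ) :=
  ({x : Fin n × Fin n | x.2 < x.1 ∧ G.Adj x.1 x.2} : Finset _).map
    (Fin.valEmbedding.prodMap Fin.valEmbedding)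

theorem mem_edgePairs {n : ℕ} {G : SimpleGraph (Fin n)} {u v : ℕ} : (u, v) ∈ edgePairs G ↔
    v < u ∧ ∃ (hu : u < n) (hv : v < n), G.Adj ⟨u, hu⟩ ⟨v, hv⟩ := by
  simp only [edgePairs, mem_map, mem_filter, mem_univ, true_and, Prod.exists,
    Function.Embedding.coe_prodMap, Prod.map_apply, Fin.valEmbedding_apply, Prod.mk.injEq]
  constructor
  · rintro ⟨a, b, ⟨hab, h⟩, rfl, rfl⟩
    exact ⟨hab, a.2, b.2, h⟩
  · rintro ⟨huv, hu, hv, h⟩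
    exact ⟨⟨u, hu⟩, ⟨v, hv⟩, ⟨huv, h⟩, rfl, rfl⟩

/-- Every edge has exactly one representation with the larger end first. -/
theorem ncard_edges {n : ℕ} (G : SimpleGraph (Fin n)) (P : Sym2 (Fin n) → Prop) :
    {e : Sym2 (Fin n) | e ∈ G.edgeSet ∧ P e}.ncard =
      {x : Fin n × Fin n | (x.2 < x.1 ∧ G.Adj x.1 x.2) ∧ P s(x.1, x.2)}.toFinset.card := by
  rw [← Set.ncard_eq_toFinset_card']
  have : {e : Sym2 (Fin n) | e ∈ G.edgeSet ∧ P e} = (fun x : Fin n × Fin n => s(x.1, x.2)) ''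
      {x : Fin n × Fin n | (x.2 < x.1 ∧ G.Adj x.1 x.2) ∧ P s(x.1, x.2)} := by
    ext e
    induction e with
    | _ a b =>
      simp only [Set.mem_ofPred_eq, Set.mem_image, Prod.exists, SimpleGraph.mem_edgeSet]
      constructor
      · rintro ⟨hab, hP⟩
        rcases lt_trichotomy a b with h | h | h
        · exact ⟨b, a, ⟨⟨h, hab.symm⟩, by rwa [Sym2.eq_swap]⟩, Sym2.eq_swap⟩
        · exact absurd h hab.ne
        · exact ⟨a, b, ⟨⟨h, hab⟩, hP⟩, rfl⟩
      · rintro ⟨c, d, ⟨⟨-, hcd⟩, hP⟩, heq⟩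
        rw [← SimpleGraph.mem_edgeSet, ← heq]
        exact ⟨hcd, hP⟩
  rw [this, Set.InjOn.ncard_image]
  rintro ⟨a, b⟩ hab ⟨c, d⟩ hcd h
  have h1 : b < a := hab.1.1
  have h2 : d < c := hcd.1.1
  rcases Sym2.eq_iff.1 h with ⟨rfl, rfl⟩ | ⟨rfl, rfl⟩
  · rfl
  · exact absurd h1 h2.not_gt

theorem sum_pairWeight {n : ℕ} (G : SimpleGraph (Fin n)) (S : Finset (Fin n)) (a b : ℝ) :
    ∑ e ∈ edgePairs G, pairWeight a b (S.map Fin.valEmbedding) e =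
      a * innerEdges G S + b * cutEdges G S := by
  rw [innerEdges, cutEdges, ncard_edges, ncard_edges, edgePairs, sum_map]
  have hw : ∀ x : Fin n × Fin n, pairWeight a b (S.map Fin.valEmbedding)
      ((Fin.valEmbedding.prodMap Fin.valEmbedding) x) =
      a * (if ∀ v ∈ s(x.1, x.2), v ∈ S then 1 else 0) +
      b * (if (∃ v ∈ s(x.1, x.2), v ∈ S) ∧ (∃ v ∈ s(x.1, x.2), v ∉ S) then 1 else 0) := by
    rintro ⟨u, v⟩
    have hmem : ∀ i : Fin n, (i : ℕ) ∈ S.map Fin.valEmbedding ↔ i ∈ S := fun i => by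
      simp [Fin.val_inj]
    simp only [pairWeight, Function.Embedding.coe_prodMap, Prod.map_apply, Fin.valEmbedding_apply,
      hmem, Sym2.mem_iff]
    by_cases hu : u ∈ S <;> by_cases hv : v ∈ S <;> simp [hu, hv]
  rw [sum_congr rfl fun x _ => hw x, sum_add_distrib, ← mul_sum, ← mul_sum, ← sum_filter,
    ← sum_filter, filter_filter, filter_filter]
  simp only [sum_const, nsmul_eq_mul, mul_one]
  congr 4 <;> ext x <;> simp

theorem exists_subset_range {n : ℕ} {P : Finset ℕ → Prop} :
    (∃ Z ⊆ range n, P Z) ↔ ∃ S : Finset (Fin n), P (S.map Fin.valEmbedding) := by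
  constructor
  · rintro ⟨Z, hZ, h⟩
    have hZ' : ∀ i ∈ Z, i < n := fun i hi => mem_range.1 (hZ hi)
    refine ⟨Z.attachFin hZ', ?_⟩
    have : (Z.attachFin hZ').map Fin.valEmbedding = Z := by
      ext i
      simp only [mem_map, mem_attachFin, Fin.valEmbedding_apply]
      constructor
      · rintro ⟨a, ha, rfl⟩
        exact ha
      · exact fun hi => ⟨⟨i, hZ' i hi⟩, hi, rfl⟩
    rwa [this]
  · rintro ⟨S, h⟩
    refine ⟨_, fun i hi => ?_, h⟩
    obtain ⟨a, -, rfl⟩ := mem_map.1 hi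
    exact mem_range.2 a.2

/-- The sign that turns a problem into a minimization problem. -/
def Problem.sign (L : Problem) : ℝ :=
  match L.goal with
  | .maximize => -1
  | .minimize => 1

/-- The value is linear in the coefficients, so the sign passes through it and reverses the
inequality. -/
theorem Problem.isYes_iff (L : Problem) {n : ℕ} (G : SimpleGraph (Fin n)) (k : ℕ) (p : ℤ) :
    L.IsYes G k p ↔ ∃ Z ⊆ range n, Z.card = k ∧ ∑ e ∈ edgePairs G,
      pairWeight (L.sign * L.α₁) (L.sign * L.α₂) Z e ≤ L.sign * p := by
  rw [exists_subset_range, Problem.IsYes]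
  refine exists_congr fun S => ?_
  rw [card_map, sum_pairWeight, Problem.val, Problem.sign]
  refine and_congr_right fun _ => ?_
  cases L.goal
  · constructor <;> intro h <;> dsimp only at * <;> linarith
  · simp

namespace TreeDecomposition

variable {n m : ℕ} {G : SimpleGraph (Fin n)} (D : TreeDecomposition G m)

/-- The data of the recursion that belong to a tree decomposition. -/
noncomputable def toDecomp (a₁ a₂ : ℝ) : Decomp where
  n := n
  m := m
  E := edgePairs G
  T i j := ∃ (hi : i < m) (hj : j < m), D.tree.Adj ⟨i, hi⟩ ⟨j, hj⟩
  -- Node `m`, which is isolated in `T`, is the artificial root with empty bag.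
  B i := if h : i < m then (D.bag ⟨i, h⟩).map Fin.valEmbedding else ∅
  a₁ := a₁
  a₂ := a₂

variable (a₁ a₂ : ℝ)

theorem mem_toDecomp_B {i v : ℕ} : v ∈ (D.toDecomp a₁ a₂).B i ↔
    ∃ (hi : i < m) (hv : v < n), (⟨v, hv⟩ : Fin n) ∈ D.bag ⟨i, hi⟩ := by
  simp only [toDecomp]
  by_cases hi : i < m
  · simp only [hi, dif_pos, mem_map, Fin.valEmbedding_apply, exists_true_left]
    constructor
    · rintro ⟨a, ha, rfl⟩
      exact ⟨a.2, ha⟩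
    · rintro ⟨hv, h⟩
      exact ⟨_, h, rfl⟩
  · simp [hi]

theorem toDecomp_wf : (D.toDecomp a₁ a₂).WF where
  symm := fun i j ⟨hi, hj, h⟩ => ⟨hj, hi, h.symm⟩
  irrefl := fun i ⟨_, _, h⟩ => h.ne rfl
  bag := fun i v hv => by
    obtain ⟨_, hv, _⟩ := (D.mem_toDecomp_B a₁ a₂).1 hv
    exact mem_range.2 hv
  edge := fun ⟨u, v⟩ he => by
    obtain ⟨-, hu, hv, -⟩ := mem_edgePairs.1 he
    exact ⟨hu, hv⟩
  root := dif_neg (lt_irrefl m)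
  lt := fun i j ⟨_, hj, _⟩ => hj
  leaf := fun A hA hne => by
    have hA' : ∀ i ∈ A, i < m := fun i hi => mem_range.1 (hA hi)
    obtain ⟨i, hi⟩ := hne
    obtain ⟨c, hc, h⟩ := exists_leaf D.isTree (A := A.attachFin hA')
      ⟨⟨i, hA' i hi⟩, mem_attachFin _ |>.2 hi⟩
    refine ⟨c, (mem_attachFin _).1 hc, ?_⟩
    rw [card_le_one] at h ⊢
    intro a ha b hb
    obtain ⟨haA, _, ha', hca⟩ := mem_filter.1 ha
    obtain ⟨hbA, _, hb', hcb⟩ := mem_filter.1 hb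
    have := h ⟨a, ha'⟩ (mem_filter.2 ⟨(mem_attachFin _).2 haA, hca⟩) ⟨b, hb'⟩
      (mem_filter.2 ⟨(mem_attachFin _).2 hbA, hcb⟩)
    exact congrArg Fin.val this

theorem toDecomp_inv : (D.toDecomp a₁ a₂).Inv (fun _ => 0) (fun _ _ => 0) := by
  refine Decomp.Inv.init ?_ ?_ ?_
  · intro v hv
    obtain ⟨i, hi⟩ := D.cover ⟨v, hv⟩
    exact ⟨i, i.2.le, (D.mem_toDecomp_B a₁ a₂).2 ⟨i.2, hv, hi⟩⟩
  · rintro ⟨u, v⟩ he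
    obtain ⟨-, hu, hv, huv⟩ := mem_edgePairs.1 he
    obtain ⟨i, hi⟩ := D.edge_cover _ _ huv
    exact ⟨i, i.2.le, (D.mem_toDecomp_B a₁ a₂).2 ⟨i.2, hu, hi.1⟩,
      (D.mem_toDecomp_B a₁ a₂).2 ⟨i.2, hv, hi.2⟩⟩
  · intro v i j hi hj
    obtain ⟨hi, hv, hvi⟩ := (D.mem_toDecomp_B a₁ a₂).1 hi
    obtain ⟨hj, _, hvj⟩ := (D.mem_toDecomp_B a₁ a₂).1 hj
    have hreach := (D.subtree ⟨v, hv⟩).preconnected ⟨⟨i, hi⟩, hvi⟩ ⟨⟨j, hj⟩, hvj⟩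
    rw [SimpleGraph.reachable_iff_reflTransGen] at hreach
    refine Relation.ReflTransGen.lift (fun x => (x.1 : ℕ)) ?_ _ _ hreach
    intro a b hab
    exact ⟨⟨a.1.2, b.1.2, hab⟩, b.1.2.le, (D.mem_toDecomp_B a₁ a₂).2 ⟨b.1.2, hv, b.2⟩⟩

theorem card_toDecomp_B_le (i : ℕ) : ((D.toDecomp a₁ a₂).B i).card ≤ D.width + 1 := by
  simp only [toDecomp, width]
  split_ifs with h
  · rw [card_map]
    have := Finset.le_sup (f := fun i => (D.bag i).card) (mem_univ (⟨i, h⟩ : Fin m))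
    omega
  · simp

end TreeDecomposition

end LocalPartition

namespace LocalPartition

open Finset Polynomial FProg

open scoped Classical

/-! ### Preparation and the main theorem -/

/-- Negate the real input of a maximization problem. -/
def flipSign : Objective → FProg
  | .maximize => .seq (.setR 0 (.sub .zero (.var 0)))
      (.seq (.setR 1 (.sub .zero (.var 1))) (.setR 2 (.sub .zero (.var 2))))
  | .minimize => .skip

/-- Set limits and initial values. -/
def setLimits : FProg :=
  .seq (.setN 3 (.add (.var 0) (.const 1)))
    (.seq (.setN 20 (.add (.add (.var 0) (.var 0)) (.add (.var 1) (.const 1))))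
      (.seq (.setN 4 (.const 1)) (.stN 3 (.const 0) (.const 1))))

/-- Tabulate the powers of two and the multiples of `n` and `m`. -/
def tabulate : FProg :=
  .forN 9 20 (.seq (.stN 3 (.add (.var 9) (.const 1)) (.add (.arr 3 (.var 9)) (.arr 3 (.var 9))))
    (.seq (.stN 4 (.add (.var 9) (.const 1)) (.add (.arr 4 (.var 9)) (.var 0)))
      (.stN 5 (.add (.var 9) (.const 1)) (.add (.arr 5 (.var 9)) (.var 1)))))

/-- Compute the maximal number of subsets of a bag in variable `4`. -/
def maxSubsets : FProg :=
  .forN 6 1 (.seq (.setN 17 (.const 1))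
    (.seq (.forN 12 0 (.ite (isOne (bagAt 6 12)) (.setN 17 (.add (.var 17) (.var 17))) .skip))
      (.ite (.natLe (.var 4) (.var 17)) (.setN 4 (.var 17)) .skip)))

/-- The machine cannot multiply; these tables, built by repeated addition, supply all products and
powers needed for addresses. -/
theorem tabulate_spec (s : Mem) (h3 : s.natArr 3 0 = 1) (h4 : s.natArr 4 0 = 0)
    (h5 : s.natArr 5 0 = 0) : ∀ i ≤ s.natVar 20, (tabulate.exec s).natArr 3 i = 2 ^ i ∧
      (tabulate.exec s).natArr 4 i = i * s.natVar 0 ∧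
      (tabulate.exec s).natArr 5 i = i * s.natVar 1 := by
  refine forN_induct (I := fun k s' => ∀ i ≤ k, s'.natArr 3 i = 2 ^ i ∧
      s'.natArr 4 i = i * s.natVar 0 ∧ s'.natArr 5 i = i * s.natVar 1) ?_ ?_
  · intro i hi
    obtain rfl : i = 0 := by omega
    simp [h3, h4, h5]
  · intro k s' _ hf hx ih i hi
    by_cases hik : i = k + 1
    · obtain ⟨i3, i4, i5⟩ := ih k le_rfl
      simp only [exec_seq, exec_stN, NExpr.eval, hx, hik, Mem.setNat_natArr,
        Mem.storeNat_natArr, Mem.storeNat_natVar, i3, i4, i5, hf.nv 0 rfl, hf.nv 1 rfl]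
      simp [pow_succ, mul_two, add_mul]
    · have := ih i (by omega)
      simpa [NExpr.eval, hx, hik] using this

/-- The width is not part of the input, so the limit for the subset enumeration is found by doubling
once per vertex of each bag and taking the maximum. The initial value 1 accounts for the root. -/
theorem maxSubsets_spec {D : Decomp} (hD : D.WF) {s : Mem} (hn : s.natVar 0 = D.n)
    (hm : s.natVar 1 = D.m) (h4 : s.natVar 4 = 1)
    (hB : ∀ i ≤ D.m, ∀ v < D.n, s.natArr 2 (s.natArr 4 i + v) = 1 ↔ v ∈ D.B i) {w : ℕ}
    (hw : ∀ i, (D.B i).card ≤ w) :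
    (∀ c ≤ D.m, 2 ^ (D.B c).card ≤ (maxSubsets.exec s).natVar 4) ∧
      1 ≤ (maxSubsets.exec s).natVar 4 ∧ (maxSubsets.exec s).natVar 4 ≤ 2 ^ w := by
  have key : (∀ c < s.natVar 1, 2 ^ (D.B c).card ≤ (maxSubsets.exec s).natVar 4) ∧
      1 ≤ (maxSubsets.exec s).natVar 4 ∧ (maxSubsets.exec s).natVar 4 ≤ 2 ^ w := by
    refine forN_induct (I := fun k s' => (∀ c < k, 2 ^ (D.B c).card ≤ s'.natVar 4) ∧
      1 ≤ s'.natVar 4 ∧ s'.natVar 4 ≤ 2 ^ w) (by simp [h4, Nat.one_le_two_pow]) ?_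
    intro c s' hc hf hx ⟨ih1, ih2, ih3⟩
    rw [hm] at hc
    simp only [exec_seq]
    set s1 := exec (.setN 17 (.const 1)) s' with hs1
    have n1 : s1.natVar 0 = D.n := (hf.nv 0 rfl).trans hn
    have c1 : s1.natVar 6 = c := hx
    have l1 : s1.natVar 4 = s'.natVar 4 := rfl
    have b1 : ∀ v < D.n, s1.natArr 2 (s1.natArr 4 c + v) = 1 ↔ v ∈ D.B c := by
      intro v hv
      rw [← hB c hc.le v hv, ← hf.na 2 rfl, ← hf.na 4 rfl]
      rfl
    have v1 : s1.natVar 17 = 1 := by simp [hs1, NExpr.eval]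
    clear_value s1
    set R : FProg := .forN 12 0 (.ite (isOne (bagAt 6 12)) (.setN 17 (.add (.var 17) (.var 17)))
      .skip) with hR
    have h17 : (R.exec s1).natVar 17 = 2 ^ (D.B c).card := by
      rw [← inter_eq_left.2 (hD.bag c), ← n1]
      refine forN_induct (I := fun k s' => s'.natVar 17 = 2 ^ (D.B c ∩ range k).card)
        (by simp [v1]) ?_
      intro v s2 hv hf2 hx2 ih
      rw [n1] at hv
      have hb : (isOne (bagAt 6 12)).Holds s2 ↔ v ∈ D.B c := by
        rw [← b1 v hv, ← hf2.na 2 rfl, ← hf2.na 4 rfl, ← c1, ← hf2.nv 6 rfl]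
        simp only [isOne, bagAt, BExpr.Holds, NExpr.eval, hx2]
      rw [card_inter_range_succ]
      by_cases h : v ∈ D.B c
      · rw [exec_ite_pos (hb.2 h), if_pos h, pow_succ, mul_two, ← ih]
        simp [NExpr.eval]
      · rw [exec_ite_neg (fun h' => h (hb.1 h')), if_neg h, add_zero, ← ih]
        simp
    have l2 : (R.exec s1).natVar 4 = s'.natVar 4 := by rw [exec_natVar R s1, l1]
    set s2 := R.exec s1
    clear_value s2
    have hwc : 2 ^ (D.B c).card ≤ 2 ^ w := Nat.pow_le_pow_right (by decide) (hw c)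
    have h1 := Nat.one_le_two_pow (n := (D.B c).card)
    by_cases hle : s'.natVar 4 ≤ 2 ^ (D.B c).card
    · rw [exec_ite_pos (show (BExpr.natLe (.var 4) (.var 17)).Holds s2 by
        simpa [BExpr.Holds, NExpr.eval, h17, l2] using hle)]
      simp only [exec_setN, NExpr.eval, h17, Mem.setNat_natVar]
      refine ⟨fun d hd => ?_, by simpa using h1, by simpa using hwc⟩
      rcases Nat.lt_succ_iff_lt_or_eq.1 hd with hd | rfl
      · simpa using (ih1 d hd).trans hle
      · simp
    · rw [exec_ite_neg (show ¬ (BExpr.natLe (.var 4) (.var 17)).Holds s2 by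
        simpa [BExpr.Holds, NExpr.eval, h17, l2] using hle)]
      simp only [exec_skip, Mem.setNat_natVar]
      refine ⟨fun d hd => ?_, by simpa [l2] using ih2, by simpa [l2] using ih3⟩
      rcases Nat.lt_succ_iff_lt_or_eq.1 hd with hd | rfl
      · simpa [l2] using ih1 d hd
      · simpa [l2] using (not_le.1 hle).le
  refine ⟨fun c hc => ?_, key.2⟩
  rcases Nat.lt_or_eq_of_le hc with hc | rfl
  · exact key.1 c (by rwa [hm])
  · simpa [hD.root] using key.2.1

/-- The state after the preparation. -/
theorem prepare_spec (L : Problem) {n m : ℕ} (G : SimpleGraph (Fin n)) (k : ℕ) (p : ℤ)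
    (D : TreeDecomposition G m) {s₁ s₂ s₃ : Mem}
    (h₁ : s₁ = setLimits.exec ((flipSign L.goal).exec (inputMem L G k p D)))
    (h₂ : s₂ = tabulate.exec s₁) (h₃ : s₃ = maxSubsets.exec s₂) :
    s₁.natVar 0 = n ∧ s₁.natVar 1 = m ∧ s₁.natVar 20 = n + n + (m + 1) ∧
    Stage (D.toDecomp (L.sign * L.α₁) (L.sign * L.α₂)) (s₃.natVar 4) s₃ ∧
    (∀ c ≤ m, 2 ^ ((D.toDecomp (L.sign * L.α₁) (L.sign * L.α₂)).B c).card ≤ s₃.natVar 4) ∧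
    1 ≤ s₃.natVar 4 ∧ s₃.natVar 4 ≤ 2 ^ (D.width + 1) ∧
    s₃.natVar 2 = k ∧ s₃.realVar 2 = L.sign * p := by
  set T := D.toDecomp (L.sign * L.α₁) (L.sign * L.α₂) with hT
  have hD : T.WF := D.toDecomp_wf _ _
  have f0 : (flipSign L.goal).exec (inputMem L G k p D) =
      { inputMem L G k p D with realVar := ((flipSign L.goal).exec (inputMem L G k p D)).realVar } := by
    cases L.goal <;> rfl
  have r0 : ((flipSign L.goal).exec (inputMem L G k p D)).realVar 0 = L.sign * L.α₁ ∧
      ((flipSign L.goal).exec (inputMem L G k p D)).realVar 1 = L.sign * L.α₂ ∧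
      ((flipSign L.goal).exec (inputMem L G k p D)).realVar 2 = L.sign * p := by
    rw [Problem.sign]
    cases L.goal <;> simp [flipSign, RExpr.eval, inputMem]
  rw [f0] at h₁
  set ρ := ((flipSign L.goal).exec (inputMem L G k p D)).realVar
  have e1 : s₁.natVar 0 = n ∧ s₁.natVar 1 = m ∧ s₁.natVar 2 = k ∧ s₁.natVar 3 = n + 1 ∧
      s₁.natVar 4 = 1 ∧ s₁.natVar 20 = n + n + (m + 1) ∧ s₁.natArr 0 = matrixArray G.Adj ∧
      s₁.natArr 1 = matrixArray D.tree.Adj ∧ s₁.natArr 2 = (matrixArray fun i v => v ∈ D.bag i) ∧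
      s₁.natArr 3 0 = 1 ∧ s₁.natArr 4 0 = 0 ∧ s₁.natArr 5 0 = 0 ∧ s₁.natArr 6 = (fun _ => 0) ∧
      s₁.natArr 8 = (fun _ => 0) ∧ s₁.realVar = ρ := by
    rw [h₁]
    exact ⟨rfl, rfl, rfl, rfl, rfl, rfl, rfl, rfl, rfl, rfl, rfl, rfl, rfl, rfl, rfl⟩
  obtain ⟨v0, v1, v2, v3, v4, v20, a0, a1, a2, a3, a4, a5, a6, a8, hρ⟩ := e1
  have htab := tabulate_spec s₁ a3 a4 a5
  rw [← h₂, v0, v1, v20] at htab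
  -- This includes the root `i = m`, whose row lies just past the end of the matrix and reads as 0.
  have hbag : ∀ i ≤ T.m, ∀ v < T.n, s₂.natArr 2 (s₂.natArr 4 i + v) = 1 ↔ v ∈ T.B i := by
    intro i hi v hv
    have hi' : i ≤ m := hi
    have hv' : v < n := hv
    rw [(htab i (by omega)).2.1, h₂, exec_natArr tabulate s₁, a2, matrixArray_eq_one _ hv', hT,
      D.mem_toDecomp_B]
    exact exists_congr fun _ => ⟨fun h => ⟨hv', h⟩, fun ⟨_, h⟩ => h⟩
  have hmax := maxSubsets_spec hD (s := s₂) (by rw [h₂, exec_natVar tabulate s₁, v0]; rfl)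
    (by rw [h₂, exec_natVar tabulate s₁, v1]; rfl) (by rw [h₂, exec_natVar tabulate s₁, v4]) hbag
    (D.card_toDecomp_B_le _ _)
  rw [← h₃] at hmax
  have hv : ∀ {y}, tabulate.wn y = false → maxSubsets.wn y = false →
      s₃.natVar y = s₁.natVar y := fun h h' => by
    rw [h₃, exec_natVar maxSubsets s₂ h', h₂, exec_natVar tabulate s₁ h]
  have hr : s₃.realVar = ρ := by
    funext y
    rw [h₃, exec_realVar maxSubsets s₂, h₂, exec_realVar tabulate s₁, hρ]
  have ha : ∀ {a}, maxSubsets.wa a = false → s₃.natArr a = s₂.natArr a := fun h => by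
    rw [h₃, exec_natArr maxSubsets s₂ h]
  have ha' : ∀ {a}, tabulate.wa a = false → s₂.natArr a = s₁.natArr a := fun h => by
    rw [h₂, exec_natArr tabulate s₁ h]
  refine ⟨v0, v1, v20, ⟨?_, fun _ _ => 0, ?_, ?_⟩, hmax.1, hmax.2.1, hmax.2.2, ?_, ?_⟩
  · refine ⟨(hv rfl rfl).trans v0, (hv rfl rfl).trans v1, (hv rfl rfl).trans v3, rfl, ?_, ?_, ?_,
      ?_, ?_, ?_⟩
    · intro u hu v hv
      have hu' : u < n := hu
      have hv' : v < n := hv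
      rw [ha rfl, ha rfl, ha' (a := 0) rfl, (htab u (by omega)).2.1, a0,
        matrixArray_eq_one _ hv']
      refine Iff.trans ?_ mem_edgePairs.symm
      exact and_congr_right fun _ => exists_congr fun _ => ⟨fun h => ⟨hv', h⟩, fun ⟨_, h⟩ => h⟩
    · intro i hi j hj
      have hi' : i < m := hi
      have hj' : j < m := hj
      rw [ha rfl, ha rfl, ha' (a := 1) rfl, (htab i (by omega)).2.2, a1,
        matrixArray_eq_one _ hj']
      exact exists_congr fun _ => ⟨fun h => ⟨hj', h⟩, fun ⟨_, h⟩ => h⟩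
    · intro i hi v hv
      rw [ha rfl, ha rfl]
      exact hbag i hi v hv
    · intro i hi
      have hi' : i ≤ 2 * n + m + 1 := hi
      rw [ha rfl, (htab i (by omega)).1]
    · rw [hr]; exact r0.1
    · rw [hr]; exact r0.2.1
  · rw [ha rfl, ha' rfl, a6]
    exact D.toDecomp_inv _ _
  -- Array `8` is still all 0, so every table entry is infinite and all tables are the zero
  -- polynomial.
  · intro d _ R _ j _
    simp [Mem.tab, ha (a := 8) rfl, ha' (a := 8) rfl, a8]
  · rw [hv rfl rfl, v2]
  · rw [hr, r0.2.2]

/-- The algorithm. -/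
def algorithm (g : Objective) : Prog :=
  .seq (FProg.seq (flipSign g) setLimits).compile
    (.seq (FProg.seq tabulate maxSubsets).compile (.seq mainLoop.compile answer.compile))

theorem algorithm_spec (L : Problem) : ∃ C d : ℕ, ∀ (n m : ℕ) (G : SimpleGraph (Fin n)) (k : ℕ)
    (p : ℤ) (D : TreeDecomposition G m), ∃ (s : Mem) (t : ℕ),
      Run (algorithm L.goal) (inputMem L G k p D) s t ∧
      AnswersCorrectly s (L.IsYes G k p) ∧ t ≤ C * 2 ^ D.width * (n + m + 1) ^ d := by
  set P₁ := FProg.seq (flipSign L.goal) setLimits with hP₁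
  set P₂ := FProg.seq tabulate maxSubsets with hP₂
  set d₁ := P₂.depth 4
  set d₂ := mainLoop.depth 4
  -- The powers of 2 come from the bound `2 * N` for the polynomial loop limits, the last factor 2
  -- from bags having up to `D.width + 1` elements.
  refine ⟨P₁.coef + P₂.coef * 2 ^ d₁ + mainLoop.coef * 2 ^ d₂ * 2 + answer.coef, d₁ + d₂, ?_⟩
  intro n m G k p D
  set s₀ := inputMem L G k p D
  obtain ⟨s₁, h₁⟩ : ∃ s, s = P₁.exec s₀ := ⟨_, rfl⟩
  obtain ⟨s₂, h₂⟩ : ∃ s, s = tabulate.exec s₁ := ⟨_, rfl⟩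
  obtain ⟨s₃, h₃⟩ : ∃ s, s = maxSubsets.exec s₂ := ⟨_, rfl⟩
  obtain ⟨hn, hm, h20, hst, hL, hE1, hE, hk, hr⟩ := prepare_spec L G k p D h₁ h₂ h₃
  set N := n + m + 1 with hN
  have hK : 1 ≤ 2 * N := by omega
  have hok : P₁.ok [] = true := by
    rw [hP₁]
    cases L.goal <;> rfl
  -- The pieces are timed separately because loop limits must stay constant within a piece, whereas
  -- variables `3`, `4` and `20` are only computed along the way. The first and the last piece
  -- contain no loops.
  obtain ⟨t₁, hr₁, ht₁⟩ := run_compile (L := []) (z := 4) (K := 1) (E := 1) le_rfl le_rfl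
    (s := s₀) hok (by simp)
  obtain ⟨t₂, hr₂, ht₂⟩ := run_compile (L := [0, 1, 20]) (z := 4) (E := 1) hK le_rfl (P := P₂)
    (s := s₁) rfl (by simp; omega)
  have h23 : P₂.exec s₁ = s₃ := by rw [h₃, h₂, hP₂]; rfl
  rw [← h₁] at hr₁
  rw [h23] at hr₂
  obtain ⟨t₃, hr₃, ht₃⟩ := run_compile (L := [0, 1, 3, 4]) (z := 4) (E := s₃.natVar 4) hK hE1
    (P := mainLoop) (s := s₃) rfl (by
      have e0 : s₃.natVar 0 = n := hst.ctx.n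
      have e1 : s₃.natVar 1 = m := hst.ctx.m
      have e3 : s₃.natVar 3 = n + 1 := hst.ctx.n1
      simp [e0, e1, e3]
      omega)
  obtain ⟨hC, ht⟩ := mainLoop_spec (D.toDecomp_wf _ _) hst hL
  have hans := answer_spec (D.toDecomp_wf _ _).edge hC ht
    (by rw [exec_natVar mainLoop s₃, hk]) (by rw [exec_realVar mainLoop s₃, hr])
  obtain ⟨t₄, hr₄, ht₄⟩ := run_compile (L := []) (z := 4) (K := 1) (E := 1) le_rfl le_rfl
    (P := answer) (s := mainLoop.exec s₃) rfl (by simp)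
  refine ⟨_, _, .seq hr₁ (.seq hr₂ (.seq hr₃ hr₄)), ?_, ?_⟩
  · rw [L.isYes_iff]
    exact hans
  · simp only [one_pow, mul_one] at ht₁ ht₂ ht₄
    -- The enumeration of subsets is the only loop limited by variable `4`, so the exponential
    -- factor enters once.
    rw [show mainLoop.expDepth 4 = 1 from rfl, pow_one] at ht₃
    have hN1 : 1 ≤ N := by omega
    have hw1 : 1 ≤ 2 ^ D.width := Nat.one_le_two_pow
    have g1 : N ^ d₁ ≤ N ^ (d₁ + d₂) := Nat.pow_le_pow_right hN1 (by omega)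
    have g2 : N ^ d₂ ≤ N ^ (d₁ + d₂) := Nat.pow_le_pow_right hN1 (by omega)
    have g0 : 1 ≤ N ^ (d₁ + d₂) := Nat.pow_pos hN1
    set X := N ^ (d₁ + d₂)
    set W := 2 ^ D.width
    have hWX : 1 ≤ W * X := Nat.mul_pos hw1 g0
    have b1 : t₁ ≤ P₁.coef * (W * X) := ht₁.trans (Nat.le_mul_of_pos_right _ hWX)
    have b4 : t₄ ≤ answer.coef * (W * X) := ht₄.trans (Nat.le_mul_of_pos_right _ hWX)
    have b2 : t₂ ≤ P₂.coef * 2 ^ d₁ * (W * X) := by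
      refine ht₂.trans ?_
      rw [mul_pow, ← mul_assoc]
      refine Nat.mul_le_mul le_rfl (g1.trans ?_)
      exact Nat.le_mul_of_pos_left _ hw1
    have b3 : t₃ ≤ mainLoop.coef * 2 ^ d₂ * 2 * (W * X) := by
      refine ht₃.trans ((Nat.mul_le_mul le_rfl hE).trans ?_)
      rw [mul_pow, pow_succ]
      calc mainLoop.coef * (2 ^ d₂ * N ^ d₂) * (W * 2) =
          mainLoop.coef * 2 ^ d₂ * 2 * (W * N ^ d₂) := by ring
        _ ≤ _ := Nat.mul_le_mul le_rfl (Nat.mul_le_mul le_rfl g2)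
    calc t₁ + (t₂ + (t₃ + t₄)) ≤ P₁.coef * (W * X) + (P₂.coef * 2 ^ d₁ * (W * X) +
          (mainLoop.coef * 2 ^ d₂ * 2 * (W * X) + answer.coef * (W * X))) := by omega
      _ = _ := by ring

end LocalPartition

open LocalPartition in
theorem mainTheorem6 (L : Problem) :
    ∃ (P : Prog) (C d : ℕ), ∀ (n m : ℕ) (G : SimpleGraph (Fin n)) (k : ℕ) (p : ℤ)
      (D : TreeDecomposition G m), ∃ (s : Mem) (t : ℕ),
        Run P (inputMem L G k p D) s t ∧
        AnswersCorrectly s (L.IsYes G k p) ∧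
        t ≤ C * 2 ^ D.width * (n + m + 1) ^ d ∧
        (D.width = treewidth G → t ≤ C * 2 ^ treewidth G * (n + m + 1) ^ d) := by
  obtain ⟨C, d, h⟩ := algorithm_spec L
  refine ⟨algorithm L.goal, C, d, fun n m G k p D => ?_⟩
  obtain ⟨s, t, hrun, hans, ht⟩ := h n m G k p D
  exact ⟨s, t, hrun, hans, ht, fun hw => hw ▸ ht⟩
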